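/- **Proof systems.** Let $\mathsf{NIZK}=(\mathsf{Setup},\mathsf{Prove},\mathsf{Verify},\mathsf{Rand})$ be a non-interactive proof system (for example Groth's) for a polynomial-time decidable relation $R$, possibly depending on the parameters, with probabilistic polynomial-time (PPT) algorithms $\mathsf{Setup}(1^\lambda)\to pp$, $\mathsf{Prove}(pp,x,w)\to\pi$, $\mathsf{Verify}(pp,x,\pi)\in\{0,1\}$ and a proof randomization algorithm $\mathsf{Rand}(pp,x,\pi)\to\pi'$. Assume that it is perfectly complete: for $pp$ generated by $\mathsf{Setup}$ and $(x,w)\in R$, every proof generated by $\mathsf{Prove}(pp,x,w)$ is accepted with probability $1$. Its proofs are *randomizable* if every PPT adversary $\mathcal A$ has negligible distinguishing advantage $|\Pr[\mathcal A\to1\mid b=1]-\Pr[\mathcal A\to1\mid b=0]|$ in the following game: $\mathcal A$ receives $1^\lambda$ and $pp\leftarrow\mathsf{Setup}(1^\lambda)$; once, it submits $(x,w,\pi)$ with $(x,w)\in R$ and $\mathsf{Verify}(pp,x,\pi)=1$, and receives $\mathsf{Rand}(pp,x,\pi)$ if $b=1$ and a fresh proof $\mathsf{Prove}(pp,x,w)$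 if $b=0$ (an invalid submission yields the empty answer); finally it outputs a bit. **User privacy experiment.** Let $\mathcal B$ be an adversary and $\mathcal D$ a simulator that plays the challenger. (1) $pp\leftarrow\mathsf{Setup}(1^\lambda)$; on $(1^\lambda,pp)$, $\mathcal D$ runs key generation and outputs public keys $pk$; $\mathcal B$ receives $(1^\lambda,pp,pk)$. (2) As often as its running time permits and in any order, $\mathcal B$ submits documents $doc'$ to "request", receiving a response $R'$ from $\mathcal D$ (as KYC provider), and queries $Q'$ to "issue", receiving the answer of $\mathcal D$ (as issuer); it runs "update" internally. (3) $\mathcal B$ submits an identity $\mathrm{zkFaith}'$ to "show", and $\mathcal D$ (as verifier) outputs $0$ or $1$, which is the output of the experiment. In all phases $\mathcal D$ keeps a state and may call a prover that on $(x,w)\in R$ returns $\mathsf{Prove}(pp,x,w)$ (and the empty string on other pairs). $U_{\mathrm{Pri}}^{\mathcal B,\mathcal D}(\lambda)$ denotes this experiment. The modified simulator $\mathcal D'$ runs identically to $\mathcal D$, except that each proof $\pi$ obtained from the prover for a statement $x$ is replaced by its randomization $\mathsf{Rand}(pp,x,\pi)$. **Theorem.** Suppose that the proofs of $\mathsf{NIZK}$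 are randomizable. Then for every PPT adversary $\mathcal B$ and every simulator $\mathcal D$ such that each of its activations takes time polynomial in $\lambda$ and $|pp|$ (whatever its state and the incoming message), there is a negligible function $\mathrm{negl}$ such that for all $\lambda$ $$\bigl|\Pr[U_{\mathrm{Pri}}^{\mathcal B,\mathcal D}(\lambda)=1]-\Pr[U_{\mathrm{Pri}}^{\mathcal B,\mathcal D'}(\lambda)=1]\bigr|<\mathrm{negl}(\lambda).$$ -/

import Mathlib

open Filter

noncomputable section

namespace ZkFaith

/-! ### Probabilistic programs on bit strings, with a step count -/

/-- Bit strings. -/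
abbrev Word := List Bool

/-- The memory of a program: registers, each holding a bit string (a stack of bits). -/
abbrev Regs := ℕ → Word

/-- Total length of a list of bit strings. -/
def totalLength (l : List Word) : ℕ := (l.map List.length).sum

/-- The initial memory: the inputs in registers `0, 1, 2, …`, all other registers empty. -/
def Regs.ofInputs (inputs : List Word) : Regs := fun i => inputs.getD i []

/-- `1ⁿ`, the security parameter in unary. -/
def unary (n : ℕ) : Word := List.replicate n true

/-- Probabilistic oracle programs. A program mentions only finitely many registers. The only loop
is the bounded loop, so that every program halts; a machine with a polynomial clock is a nest of
such loops around its transition function, two registers representing one tape. -/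
inductive Prog : Type
  /-- Do nothing. -/
  | skip : Prog
  /-- Put the bit `b` in front of register `r`. -/
  | push (r : ℕ) (b : Bool) : Prog
  /-- Remove the first bit of register `r`, if there is one. -/
  | pop (r : ℕ) : Prog
  /-- Put a fair random bit in front of register `r`. -/
  | coin (r : ℕ) : Prog
  /-- Move the content of `src` to `dst`, leaving `src` empty. -/
  | move (dst src : ℕ) : Prog
  /-- Copy the content of `src` to `dst`. -/
  | copy (dst src : ℕ) : Prog
  /-- Send the contents of the registers `args` to the oracle, store the answer in `res`. -/
  | call (args : List ℕ) (res : ℕ) : Prog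
  /-- Sequential composition. -/
  | seq (p q : Prog) : Prog
  /-- Run `p` if the first bit of register `r` is `b` (`none`: the register is empty), else `q`. -/
  | ifTop (r : ℕ) (b : Option Bool) (p q : Prog) : Prog
  /-- Run `p` as many times as register `r` has bits on entry. -/
  | loop (r : ℕ) (p : Prog) : Prog

/-- A stateful randomized oracle: query and state to answer and new state. -/
abbrev Oracle (σ : Type) := List Word → σ → PMF (Word × σ)

/-- A configuration: registers, state of the oracle, number of steps taken so far. -/
structure Cfg (σ : Type) where
  regs : Regs
  env : σ
  time : ℕ

namespace Cfg

variable {σ : Type}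

/-- Charge `k` steps. -/
def tick (c : Cfg σ) (k : ℕ) : Cfg σ := { c with time := c.time + k }

/-- Overwrite register `r`. -/
def set (c : Cfg σ) (r : ℕ) (w : Word) : Cfg σ := { c with regs := Function.update c.regs r w }

/-- The start of a run. -/
def start (inputs : List Word) (s : σ) : Cfg σ := ⟨Regs.ofInputs inputs, s, 0⟩

end Cfg

/-- Repeat a randomized transformation `n` times. -/
def repeatM {α : Type} (f : α → PMF α) : ℕ → α → PMF α
  | 0, a => PMF.pure a
  | n + 1, a => (f a).bind (repeatM f n)

/-- The distribution of the final configuration of a program that runs with oracle `O`. One step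
is charged for each instruction and each round of a loop; copying a string and sending it to the
oracle cost its length in addition. -/
def Prog.run {σ : Type} (O : Oracle σ) : Prog → Cfg σ → PMF (Cfg σ)
  | .skip, c => PMF.pure (c.tick 1)
  | .push r b, c => PMF.pure ((c.set r (b :: c.regs r)).tick 1)
  | .pop r, c => PMF.pure ((c.set r (c.regs r).tail).tick 1)
  | .coin r, c =>
      (PMF.uniformOfFintype Bool).bind fun b => PMF.pure ((c.set r (b :: c.regs r)).tick 1)
  | .move dst src, c => PMF.pure (((c.set src []).set dst (c.regs src)).tick 1)
  | .copy dst src, c => PMF.pure ((c.set dst (c.regs src)).tick (1 + (c.regs src).length))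
  | .call args res, c =>
      (O (args.map c.regs) c.env).bind fun a =>
        PMF.pure ((({ c with env := a.2 } : Cfg σ).set res a.1).tick
          (1 + totalLength (args.map c.regs)))
  | .seq p q, c => (p.run O c).bind (q.run O)
  | .ifTop r b p q, c =>
      if (c.regs r).head? = b then p.run O (c.tick 1) else q.run O (c.tick 1)
  | .loop r p, c =>
      repeatM (p.run O) (c.regs r).length (c.tick (1 + (c.regs r).length))

/-- The oracle that is not there. -/
def noOracle : Oracle Unit := fun _ s => PMF.pure ([], s)

/-- The output distribution of a randomized algorithm without oracle: register `0` at the end. -/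
def Prog.out (p : Prog) (inputs : List Word) : PMF Word :=
  (p.run noOracle (Cfg.start inputs ())).map fun c => c.regs 0

/-- Whatever the oracle does, on these inputs `p` always halts within `t` steps. -/
def Prog.TimeBound (p : Prog) (inputs : List Word) (t : ℕ) : Prop :=
  ∀ (σ : Type) (O : Oracle σ) (s : σ), ∀ c ∈ (p.run O (Cfg.start inputs s)).support, c.time ≤ t

/-- Probabilistic polynomial time: strictly polynomial in the total length of the inputs. -/
def Prog.PPT (p : Prog) : Prop :=
  ∃ f : Polynomial ℕ, ∀ inputs : List Word, p.TimeBound inputs (f.eval (totalLength inputs))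

/-- Negligible functions of the security parameter. -/
def Negligible (ν : ℕ → ℝ) : Prop :=
  Asymptotics.SuperpolynomialDecay atTop (fun n : ℕ => (n : ℝ)) ν

/-- The probability that an experiment outputs `1`. -/
def prOne (e : PMF Bool) : ℝ := (e true).toReal

/-! ### Non-interactive proof systems and randomizability -/

/-- A non-interactive proof system for a polynomial-time decidable relation, together with an
algorithm that randomizes proofs. -/
structure NIZK where
  /-- `Setup(1ⁿ) → pp`. -/
  setup : Prog
  /-- `Prove(pp, x, w) → π`. -/
  prove : Prog
  /-- `Verify(pp, x, π)`, which accepts by returning the string `1`. -/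
  verify : Prog
  /-- `Rand(pp, x, π) → π'`. -/
  rand : Prog
  /-- The relation between statements `x` and witnesses `w`, for parameters `pp`. -/
  rel : Word → Word → Word → Bool
  /-- A program that decides the relation. -/
  decideRel : Prog
  decideRel_out : ∀ pp x w, decideRel.out [pp, x, w] = PMF.pure [rel pp x w]
  setup_ppt : setup.PPT
  prove_ppt : prove.PPT
  verify_ppt : verify.PPT
  rand_ppt : rand.PPT
  decideRel_ppt : decideRel.PPT

namespace NIZK

/-- Perfect completeness: honestly generated proofs of true statements are accepted. -/
def Complete (N : NIZK) : Prop :=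
  ∀ n : ℕ, ∀ pp ∈ (N.setup.out [unary n]).support, ∀ x w, N.rel pp x w = true →
    ∀ π ∈ (N.prove.out [pp, x, w]).support, N.verify.out [pp, x, π] = PMF.pure [true]

/-- The challenge of the randomizability game. It is given once (the state records whether it is
used up): on a statement `x`, a witness `w` for it and an accepted proof `π` of it, all chosen by
the adversary, return a randomization of `π` if `b`, and a fresh proof otherwise. -/
def challenge (N : NIZK) (b : Bool) (pp : Word) : Oracle Bool := fun args used =>
  let x := args.getD 0 []
  let w := args.getD 1 []
  let π := args.getD 2 []
  if used = false ∧ N.rel pp x w = true then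
    (N.verify.out [pp, x, π]).bind fun v =>
      if v = [true] then
        (if b then N.rand.out [pp, x, π] else N.prove.out [pp, x, w]).map fun π' => (π', true)
      else PMF.pure ([], true)
  else PMF.pure ([], true)

/-- The randomizability game: the adversary gets `1ⁿ` and the parameters, asks for its challenge,
and outputs a guess. -/
def randGame (N : NIZK) (A : Prog) (b : Bool) (n : ℕ) : PMF Bool :=
  (N.setup.out [unary n]).bind fun pp =>
    (A.run (N.challenge b pp) (Cfg.start [unary n, pp] false)).map fun c =>
      decide (c.regs 0 = [true])

/-- Proofs are randomizable: no PPT adversary can tell a randomized proof from a fresh one. -/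
def Randomizable (N : NIZK) : Prop :=
  ∀ A : Prog, A.PPT →
    Negligible fun n => |prOne (N.randGame A true n) - prOne (N.randGame A false n)|

/-- The prover that answers a pair `(x, w)` of the relation with a fresh proof of `x`. -/
def freshProofs (N : NIZK) (pp : Word) : Oracle Unit := fun args s =>
  let x := args.getD 0 []
  let w := args.getD 1 []
  if N.rel pp x w = true then (N.prove.out [pp, x, w]).map fun π => (π, s)
  else PMF.pure ([], s)

/-- The same prover, which randomizes each proof before it hands it over. -/
def randomizedProofs (N : NIZK) (pp : Word) : Oracle Unit := fun args s =>
  let x := args.getD 0 []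
  let w := args.getD 1 []
  if N.rel pp x w = true then
    (N.prove.out [pp, x, w]).bind fun π => (N.rand.out [pp, x, π]).map fun π' => (π', s)
  else PMF.pure ([], s)

end NIZK

/-! ### The user privacy experiment -/

/-- A simulator of the challenger: its code for the phases of the protocol. In every activation it
obtains the NIZK proofs that it needs by calls of a prover on a statement and a witness. -/
structure Simulator where
  /-- Set-up and key generation: on `(1ⁿ, pp)`, returns the public keys. -/
  keyGen : Prog
  /-- The KYC provider: on `(1ⁿ, pp, st, doc')`, returns the response `R'`. -/
  request : Prog
  /-- The issuer: on `(1ⁿ, pp, st, Q')`, returns the issued signature and proofs. -/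
  issue : Prog
  /-- The verifier: on `(1ⁿ, pp, st, zkFaith')`, returns the string `1` for acceptance. -/
  showPhase : Prog

/-- One activation: the answer is left in register `0`, the state of the simulator that is kept
for its next activation in register `1`. -/
def activate (P : Oracle Unit) (code : Prog) (inputs : List Word) : PMF (Word × Word) :=
  (code.run P (Cfg.start inputs ())).map fun c => (c.regs 0, c.regs 1)

namespace Simulator

/-- An interactive PPT machine: every activation takes a number of steps that is polynomial in
the security parameter and the size of the parameters, whatever messages arrive. -/
def PPT (D : Simulator) : Prop :=
  ∃ f : Polynomial ℕ, ∀ (n : ℕ) (pp : Word),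
    D.keyGen.TimeBound [unary n, pp] (f.eval (n + pp.length)) ∧
    ∀ st msg : Word,
      D.request.TimeBound [unary n, pp, st, msg] (f.eval (n + pp.length)) ∧
      D.issue.TimeBound [unary n, pp, st, msg] (f.eval (n + pp.length)) ∧
      D.showPhase.TimeBound [unary n, pp, st, msg] (f.eval (n + pp.length))

/-- The oracle that the adversary faces, with the state of the simulator as its state. A query
consists of a selector and a message; the selector `1` stands for "issue", any other one for
"request". -/
def oracle (D : Simulator) (P : Oracle Unit) (n : ℕ) (pp : Word) : Oracle Word := fun args st =>
  activate P (if args.getD 0 [] = [true] then D.issue else D.request)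
    [unary n, pp, st, args.getD 1 []]

end Simulator

/-- The user privacy experiment between the adversary `B` and the simulator `D`, where `prover`
(given the parameters) generates the NIZK proofs of `D`. The parameters are generated, `D`
generates the keys, `B` gets the parameters and the public keys, makes "request" and "issue"
queries in any order, and finally submits `zkFaith'`; the output is the verdict of "show". -/
def privacyExperiment (N : NIZK) (prover : Word → Oracle Unit) (D : Simulator) (B : Prog)
    (n : ℕ) : PMF Bool :=
  (N.setup.out [unary n]).bind fun pp =>
    (activate (prover pp) D.keyGen [unary n, pp]).bind fun k =>
      (B.run (D.oracle (prover pp) n pp) (Cfg.start [unary n, pp, k.1] k.2)).bind fun c =>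
        (activate (prover pp) D.showPhase [unary n, pp, c.env, c.regs 0]).map fun v =>
          decide (v.1 = [true])

/-- The experiment run with the simulator `D`. -/
def UPri (N : NIZK) (B : Prog) (D : Simulator) : ℕ → PMF Bool :=
  privacyExperiment N N.freshProofs D B

/-- The experiment run with the modified simulator `D'`: it runs identically to `D`, except that
every NIZK proof is randomized. -/
def UPriModified (N : NIZK) (B : Prog) (D : Simulator) : ℕ → PMF Bool :=
  privacyExperiment N N.randomizedProofs D B

end ZkFaith

end

noncomputable section

namespace ZkFaith

/-! ### Couplings of probability mass functions -/

/-! The proof is a hybrid argument over the proofs that the simulator obtains. Let `hybrid` with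
index `j` be the privacy experiment in which the first `j` proofs are randomized and the later ones
are fresh. Index `0` is the experiment with `D`. An activation of the simulator and a run of the
adversary take polynomially many steps and every call costs a step, so only polynomially many proofs
are requested; from some index `(n + 2) ^ b` on, the hybrid is therefore the experiment with the
modified simulator (`exists_hybrid_bounds`).

The adversary `reduction` against randomizability draws `i` uniformly below a power of two `2 ^ k >
(n + 2) ^ b` and runs the whole privacy experiment by itself: it randomizes the first `i` proofs,
submits the next one as its challenge, and leaves all later ones fresh. Perfect completeness ensures
that an honest proof is a valid submission. Its challenge is then answered by a randomization of
that proof or by a new proof, so that the run is distributed as hybrid `i + 1` or hybrid `i`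
(`NIZK.gameProver_coupled`, `randGame_reduction`). Averaging over `i` telescopes (`prOne_hybrids`):
the distance of the two extreme hybrids is `2 ^ k` times the advantage of the reduction, and `2 ^ k
≤ 2 * (n + 2) ^ b` is polynomial.

Most of the work is to write the reduction as an actual program and to bound its time. Programs are
inlined into disjoint residue classes of registers modulo `8`, with their oracle calls replaced by
code (`inline_coupled`). Correctness and running time are proved together, by couplings of the run
of the code with the ideal distribution (`reduction_coupled`). The time bound must hold for every
input and every oracle, and an arbitrary oracle may give arbitrarily long answers. The reduction
therefore truncates the public keys before it starts the adversary; in the true experiments the keys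
are short enough for this to have no effect (`privacyExperiment_eq`). -/

theorem bind_congr_support {α β : Type*} {p : PMF α} {f g : α → PMF β}
    (h : ∀ a ∈ p.support, f a = g a) : p.bind f = p.bind g := by
  ext b
  simp only [PMF.bind_apply]
  refine tsum_congr fun a => ?_
  by_cases ha : p a = 0
  · simp [ha]
  · rw [h a ((PMF.mem_support_iff _ _).2 ha)]

/-- There is a coupling of `μ` and `ν` whose support satisfies the relation `R`. -/
def Coupled {α β : Type*} (R : α → β → Prop) (μ : PMF α) (ν : PMF β) : Prop :=
  ∃ κ : PMF (α × β), κ.map Prod.fst = μ ∧ κ.map Prod.snd = ν ∧ ∀ x ∈ κ.support, R x.1 x.2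

namespace Coupled

variable {α β γ δ : Type*} {R : α → β → Prop} {μ : PMF α} {ν : PMF β}

theorem pure {a : α} {b : β} (h : R a b) : Coupled R (PMF.pure a) (PMF.pure b) := by
  refine ⟨PMF.pure (a, b), by simp [PMF.pure_map], by simp [PMF.pure_map], ?_⟩
  intro x hx
  simp only [PMF.support_pure, Set.mem_singleton_iff] at hx
  subst hx
  exact h

theorem refl (μ : PMF α) : Coupled (fun a b => a = b) μ μ := by
  refine ⟨μ.map fun a => (a, a), ?_, ?_, ?_⟩
  · rw [PMF.map_comp]; exact PMF.map_id μ
  · rw [PMF.map_comp]; exact PMF.map_id μ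
  · intro x hx
    obtain ⟨a, -, rfl⟩ := (PMF.mem_support_map_iff _ _ _).1 hx
    rfl

/-- The independent coupling serves wherever nothing has to be related: off the relation in `bind`,
and in runs that have exceeded their time bound. -/
theorem product (μ : PMF α) (ν : PMF β) :
    Coupled (fun a b => a ∈ μ.support ∧ b ∈ ν.support) μ ν := by
  refine ⟨μ.bind fun a => ν.map fun b => (a, b), ?_, ?_, ?_⟩
  · rw [PMF.map_bind]
    have : ∀ a : α, (ν.map fun b => (a, b)).map Prod.fst = PMF.pure a := fun a => by
      rw [PMF.map_comp]; exact PMF.map_const ν a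
    simp only [this, PMF.bind_pure]
  · rw [PMF.map_bind]
    have : ∀ a : α, (ν.map fun b => (a, b)).map Prod.snd = ν := fun a => by
      rw [PMF.map_comp]; exact PMF.map_id ν
    simp only [this, PMF.bind_const]
  · intro x hx
    obtain ⟨a, ha, hx⟩ := (PMF.mem_support_bind_iff _ _ _).1 hx
    obtain ⟨b, hb, rfl⟩ := (PMF.mem_support_map_iff _ _ _).1 hx
    exact ⟨ha, hb⟩

theorem with_support (h : Coupled R μ ν) :
    Coupled (fun a b => R a b ∧ a ∈ μ.support ∧ b ∈ ν.support) μ ν := by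
  obtain ⟨κ, h1, h2, h3⟩ := h
  refine ⟨κ, h1, h2, fun x hx => ⟨h3 x hx, ?_, ?_⟩⟩
  · rw [← h1]; exact (PMF.mem_support_map_iff _ _ _).2 ⟨x, hx, rfl⟩
  · rw [← h2]; exact (PMF.mem_support_map_iff _ _ _).2 ⟨x, hx, rfl⟩

theorem mono {S : α → β → Prop} (h : Coupled R μ ν) (hS : ∀ a b, R a b → S a b) :
    Coupled S μ ν := by
  obtain ⟨κ, h1, h2, h3⟩ := h
  exact ⟨κ, h1, h2, fun x hx => hS _ _ (h3 x hx)⟩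

theorem mono_support {S : α → β → Prop} (h : Coupled R μ ν)
    (hS : ∀ a b, R a b → a ∈ μ.support → b ∈ ν.support → S a b) : Coupled S μ ν :=
  h.with_support.mono fun a b hab => hS a b hab.1 hab.2.1 hab.2.2

/-- Couplings compose like kernels. The kernel has to be defined on all pairs, so pairs outside `R`,
which have probability zero, receive the independent coupling. -/
theorem bind {S : γ → δ → Prop} {f : α → PMF γ} {g : β → PMF δ} (h : Coupled R μ ν)
    (hfg : ∀ a b, R a b → Coupled S (f a) (g b)) : Coupled S (μ.bind f) (ν.bind g) := by
  obtain ⟨κ, h1, h2, h3⟩ := h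
  have key : ∀ x : α × β, ∃ k : PMF (γ × δ), k.map Prod.fst = f x.1 ∧ k.map Prod.snd = g x.2 ∧
      (R x.1 x.2 → ∀ y ∈ k.support, S y.1 y.2) := by
    intro x
    by_cases hx : R x.1 x.2
    · obtain ⟨k, k1, k2, k3⟩ := hfg _ _ hx
      exact ⟨k, k1, k2, fun _ => k3⟩
    · obtain ⟨k, k1, k2, -⟩ := product (f x.1) (g x.2)
      exact ⟨k, k1, k2, fun hx' => absurd hx' hx⟩
  choose k k1 k2 k3 using key
  refine ⟨κ.bind k, ?_, ?_, ?_⟩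
  · rw [PMF.map_bind, ← h1, PMF.bind_map]; simp only [k1]; rfl
  · rw [PMF.map_bind, ← h2, PMF.bind_map]; simp only [k2]; rfl
  · intro y hy
    obtain ⟨x, hx, hy⟩ := (PMF.mem_support_bind_iff _ _ _).1 hy
    exact k3 x (h3 x hx) y hy

theorem bind_support {S : γ → δ → Prop} {f : α → PMF γ} {g : β → PMF δ} (h : Coupled R μ ν)
    (hfg : ∀ a b, R a b → a ∈ μ.support → b ∈ ν.support → Coupled S (f a) (g b)) :
    Coupled S (μ.bind f) (ν.bind g) :=
  h.with_support.bind fun a b hab => hfg a b hab.1 hab.2.1 hab.2.2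

/-- A coupling with a law that has been extended by a deterministic step on the left. -/
theorem bind_left {S : γ → β → Prop} {f : α → PMF γ} (h : Coupled R μ ν)
    (hf : ∀ a b, R a b → Coupled S (f a) (PMF.pure b)) : Coupled S (μ.bind f) ν := by
  have := h.bind (g := PMF.pure) hf
  rwa [PMF.bind_pure] at this

theorem map {S : γ → δ → Prop} {f : α → γ} {g : β → δ} (h : Coupled R μ ν)
    (hfg : ∀ a b, R a b → S (f a) (g b)) : Coupled S (μ.map f) (ν.map g) :=
  h.bind fun a b hab => pure (hfg a b hab)

theorem map_right {S : α → δ → Prop} {g : β → δ} (h : Coupled R μ ν)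
    (hfg : ∀ a b, R a b → S a (g b)) : Coupled S μ (ν.map g) := by
  have := h.map (f := id) (g := g) hfg
  rwa [PMF.map_id] at this

/-- This turns a time bound that is part of a coupling into one for every possible outcome on the
left. -/
theorem exists_of_mem (h : Coupled R μ ν) {a : α} (ha : a ∈ μ.support) :
    ∃ b ∈ ν.support, R a b := by
  obtain ⟨κ, h1, h2, h3⟩ := h
  rw [← h1] at ha
  obtain ⟨x, hx, rfl⟩ := (PMF.mem_support_map_iff _ _ _).1 ha
  exact ⟨x.2, by rw [← h2]; exact (PMF.mem_support_map_iff _ _ _).2 ⟨x, hx, rfl⟩, h3 x hx⟩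

theorem map_eq {f : α → γ} {g : β → γ} (h : Coupled R μ ν) (hfg : ∀ a b, R a b → f a = g b) :
    μ.map f = ν.map g := by
  obtain ⟨κ, h1, h2, h3⟩ := h
  rw [← h1, ← h2, PMF.map_comp, PMF.map_comp]
  exact bind_congr_support fun x hx => by simp [hfg _ _ (h3 x hx)]

theorem bind_eq {f : α → PMF γ} {g : β → PMF γ} (h : Coupled R μ ν)
    (hfg : ∀ a b, R a b → a ∈ μ.support → b ∈ ν.support → f a = g b) : μ.bind f = ν.bind g := by
  obtain ⟨κ, h1, h2, h3⟩ := h.with_support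
  rw [← h1, ← h2, PMF.bind_map, PMF.bind_map]
  exact bind_congr_support fun x hx =>
    hfg _ _ (h3 x hx).1 (by simpa only [h1] using (h3 x hx).2.1)
      (by simpa only [h2] using (h3 x hx).2.2)

end Coupled

/-! ### General facts on runs of programs -/

section Run

variable {σ τ : Type}

@[simp] theorem Cfg.tick_regs (c : Cfg σ) (k : ℕ) : (c.tick k).regs = c.regs := rfl
@[simp] theorem Cfg.tick_env (c : Cfg σ) (k : ℕ) : (c.tick k).env = c.env := rfl
@[simp] theorem Cfg.tick_time (c : Cfg σ) (k : ℕ) : (c.tick k).time = c.time + k := rfl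
@[simp] theorem Cfg.set_regs (c : Cfg σ) (r : ℕ) (w : Word) :
    (c.set r w).regs = Function.update c.regs r w := rfl
@[simp] theorem Cfg.set_env (c : Cfg σ) (r : ℕ) (w : Word) : (c.set r w).env = c.env := rfl
@[simp] theorem Cfg.set_time (c : Cfg σ) (r : ℕ) (w : Word) : (c.set r w).time = c.time := rfl

theorem repeatM_add {α : Type} (f : α → PMF α) (m n : ℕ) (a : α) :
    repeatM f (m + n) a = (repeatM f m a).bind (repeatM f n) := by
  induction m generalizing a with
  | zero => simp [repeatM]
  | succ m ih =>
    rw [Nat.add_right_comm]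
    simp only [repeatM, PMF.bind_bind]
    exact congrArg _ (funext ih)

theorem repeatM_succ_right {α : Type} (f : α → PMF α) (n : ℕ) (a : α) :
    repeatM f (n + 1) a = (repeatM f n a).bind f := by
  rw [repeatM_add]
  congr 1
  funext b
  simp only [repeatM, PMF.bind_pure]

theorem repeatM_invariant {α : Type} {f : α → PMF α} {P : α → Prop}
    (h : ∀ a, P a → ∀ b ∈ (f a).support, P b) (n : ℕ) {a b : α} (ha : P a)
    (hb : b ∈ (repeatM f n a).support) : P b := by
  induction n generalizing a with
  | zero =>
    simp only [repeatM, PMF.support_pure, Set.mem_singleton_iff] at hb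
    exact hb ▸ ha
  | succ n ih =>
    obtain ⟨a', ha', hb⟩ := (PMF.mem_support_bind_iff _ _ _).1 hb
    exact ih (h a ha a' ha') hb

theorem repeatM_coupled {α β : Type} {f : α → PMF α} {g : β → PMF β} {R : α → β → Prop}
    (h : ∀ a b, R a b → Coupled R (f a) (g b)) (n : ℕ) {a : α} {b : β} (hab : R a b) :
    Coupled R (repeatM f n a) (repeatM g n b) := by
  induction n generalizing a b with
  | zero => exact .pure hab
  | succ n ih => exact (h a b hab).bind fun a b hab => ih hab

/-- An invariant of single instructions is an invariant of runs. -/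
theorem run_invariant {O : Oracle σ} {P : Cfg σ → Prop}
    (htick : ∀ c k, P c → P (c.tick k))
    (hset : ∀ c r w k, P c → (w.length ≤ 1 + (c.regs r).length ∧ k = 1 ∨
      ∃ r', w.length ≤ (c.regs r').length) → P ((c.set r w).tick k))
    (hcall : ∀ c (args : List ℕ) (res : ℕ), P c → ∀ a ∈ (O (args.map c.regs) c.env).support,
      P ((({ c with env := a.2 } : Cfg σ).set res a.1).tick (1 + totalLength (args.map c.regs))))
    (p : Prog) {c d : Cfg σ} (hc : P c) (hd : d ∈ (p.run O c).support) : P d := by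
  induction p generalizing c d with
  | skip =>
    simp only [Prog.run, PMF.support_pure, Set.mem_singleton_iff] at hd
    subst hd
    exact htick _ _ hc
  | push r b =>
    simp only [Prog.run, PMF.support_pure, Set.mem_singleton_iff] at hd
    subst hd
    exact hset _ _ _ _ hc (.inl ⟨by simp [Nat.add_comm], rfl⟩)
  | pop r =>
    simp only [Prog.run, PMF.support_pure, Set.mem_singleton_iff] at hd
    subst hd
    exact hset _ _ _ _ hc (.inr ⟨r, by simp⟩)
  | coin r =>
    obtain ⟨b, -, hd⟩ := (PMF.mem_support_bind_iff _ _ _).1 hd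
    simp only [PMF.support_pure, Set.mem_singleton_iff] at hd
    subst hd
    exact hset _ _ _ _ hc (.inl ⟨by simp [Nat.add_comm], rfl⟩)
  | move dst src =>
    simp only [Prog.run, PMF.support_pure, Set.mem_singleton_iff] at hd
    subst hd
    -- The semantics empties `src` before it writes `dst`. For distinct registers the order is
    -- exchanged, so that each string written is no longer than the current content of some
    -- register.
    by_cases hl : dst = src
    · subst hl
      have : (c.set dst []).set dst (c.regs dst) = c := by simp [Cfg.set]
      rw [this]
      exact htick _ _ hc
    · have h1 := hset c dst (c.regs src) 0 hc (.inr ⟨src, le_rfl⟩)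
      have h2 := hset _ src [] 1 h1 (.inr ⟨src, by simp⟩)
      have : ((c.set dst (c.regs src)).tick 0).set src [] =
          (c.set src []).set dst (c.regs src) := by
        simp only [Cfg.set, Cfg.tick, Nat.add_zero]
        rw [Function.update_comm hl]
      rwa [this] at h2
  | copy dst src =>
    simp only [Prog.run, PMF.support_pure, Set.mem_singleton_iff] at hd
    subst hd
    exact hset _ _ _ _ hc (.inr ⟨src, le_rfl⟩)
  | call args res =>
    obtain ⟨a, ha, hd⟩ := (PMF.mem_support_bind_iff _ _ _).1 hd
    simp only [PMF.support_pure, Set.mem_singleton_iff] at hd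
    subst hd
    exact hcall _ _ _ hc a ha
  | seq p q ihp ihq =>
    obtain ⟨e, he, hd⟩ := (PMF.mem_support_bind_iff _ _ _).1 hd
    exact ihq (ihp hc he) hd
  | ifTop r b p q ihp ihq =>
    simp only [Prog.run] at hd
    split_ifs at hd
    · exact ihp (htick _ _ hc) hd
    · exact ihq (htick _ _ hc) hd
  | loop r p ih =>
    exact repeatM_invariant (fun a ha b hb => ih ha hb) _ (htick _ _ hc) hd

theorem le_time_of_mem_run {O : Oracle σ} (p : Prog) {c d : Cfg σ}
    (hd : d ∈ (p.run O c).support) : c.time ≤ d.time := by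
  refine run_invariant (P := fun d => c.time ≤ d.time) ?_ ?_ ?_ p le_rfl hd
  · intro c k h; simp only [Cfg.tick_time]; omega
  · intro c r w k h _; simp only [Cfg.tick_time, Cfg.set_time]; omega
  · intro c args res h a _; simp only [Cfg.tick_time, Cfg.set_time]; omega

/-- The length of the registers at the end of a run, if the answers of the oracle are short. -/
theorem length_le_of_mem_run {O : Oracle σ} {L T : ℕ}
    (hO : ∀ args s, totalLength args ≤ T → ∀ a ∈ (O args s).support, a.1.length ≤ L)
    (p : Prog) {c d : Cfg σ} (hc : ∀ r, (c.regs r).length ≤ L + c.time)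
    (hd : d ∈ (p.run O c).support) (hT : d.time ≤ T) (r : ℕ) :
    (d.regs r).length ≤ L + d.time := by
  -- The invariant is conditional on the clock: answers are known to be short only for queries of
  -- length at most `T`, and the length of a query is charged to the clock.
  refine run_invariant (P := fun d => d.time ≤ T → ∀ r, (d.regs r).length ≤ L + d.time)
    ?_ ?_ ?_ p (fun _ => hc) hd hT r
  · intro c k h hk r
    simp only [Cfg.tick_time, Cfg.tick_regs] at *
    have := h (by omega) r
    omega
  · intro c r w k h hw hk r'
    simp only [Cfg.tick_time, Cfg.set_time, Cfg.tick_regs, Cfg.set_regs] at *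
    have h := h (by omega)
    rw [Function.update_apply]
    split_ifs with hr
    · rcases hw with ⟨hw, rfl⟩ | ⟨r'', hw⟩
      · have := h r; omega
      · have := h r''; omega
    · have := h r'; omega
  · intro c args res h a ha hk r'
    simp only [Cfg.tick_time, Cfg.set_time, Cfg.tick_regs, Cfg.set_regs] at *
    have h := h (by omega)
    rw [Function.update_apply]
    split_ifs with hr
    · have := hO _ _ (by omega) a ha; omega
    · have := h r'; omega

/-- Change of the oracle: as long as no more than `T` steps are made, the runs agree if the
oracles agree up to a relation `E` between their states that may depend on the time. -/
theorem run_coupled {O₁ : Oracle σ} {O₂ : Oracle τ} {E : ℕ → σ → τ → Prop} {T : ℕ}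
    (hmono : ∀ t t' s₁ s₂, t ≤ t' → E t s₁ s₂ → E t' s₁ s₂)
    (hO : ∀ t args s₁ s₂, t + 1 + totalLength args ≤ T → E t s₁ s₂ →
      Coupled (fun a b => a.1 = b.1 ∧ E (t + 1 + totalLength args) a.2 b.2)
        (O₁ args s₁) (O₂ args s₂))
    (p : Prog) {c₁ : Cfg σ} {c₂ : Cfg τ}
    (h : c₂.time ≤ T → c₁.regs = c₂.regs ∧ c₁.time = c₂.time ∧ E c₂.time c₁.env c₂.env) :
    Coupled (fun d₁ d₂ => d₂.time ≤ T →
      d₁.regs = d₂.regs ∧ d₁.time = d₂.time ∧ E d₂.time d₁.env d₂.env)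
      (p.run O₁ c₁) (p.run O₂ c₂) := by
  -- The clock never goes back, so beyond `T` the conclusion is vacuous and any coupling will do.
  have triv : ∀ (p : Prog) (c₁ : Cfg σ) (c₂ : Cfg τ), ¬ c₂.time ≤ T →
      Coupled (fun d₁ d₂ => d₂.time ≤ T →
        d₁.regs = d₂.regs ∧ d₁.time = d₂.time ∧ E d₂.time d₁.env d₂.env)
        (p.run O₁ c₁) (p.run O₂ c₂) := fun p c₁ c₂ hT =>
    (Coupled.product _ _).mono fun a b hab hb =>
      absurd ((le_time_of_mem_run p hab.2).trans hb) hT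
  induction p generalizing c₁ c₂ with
  | skip =>
    refine .pure fun hT => ?_
    obtain ⟨h1, h2, h3⟩ := h (by simp at hT; omega)
    exact ⟨h1, by simp [h2], hmono _ _ _ _ (by simp) h3⟩
  | push r b =>
    refine .pure fun hT => ?_
    obtain ⟨h1, h2, h3⟩ := h (by simp at hT; omega)
    exact ⟨by simp [h1], by simp [h2], hmono _ _ _ _ (by simp) h3⟩
  | pop r =>
    refine .pure fun hT => ?_
    obtain ⟨h1, h2, h3⟩ := h (by simp at hT; omega)
    exact ⟨by simp [h1], by simp [h2], hmono _ _ _ _ (by simp) h3⟩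
  | coin r =>
    refine (Coupled.refl _).bind ?_
    rintro b _ rfl
    refine .pure fun hT => ?_
    obtain ⟨h1, h2, h3⟩ := h (by simp at hT; omega)
    exact ⟨by simp [h1], by simp [h2], hmono _ _ _ _ (by simp) h3⟩
  | move dst src =>
    refine .pure fun hT => ?_
    obtain ⟨h1, h2, h3⟩ := h (by simp at hT; omega)
    exact ⟨by simp [h1], by simp [h2], hmono _ _ _ _ (by simp) h3⟩
  | copy dst src =>
    refine .pure fun hT => ?_
    obtain ⟨h1, h2, h3⟩ := h (by simp at hT; omega)
    exact ⟨by simp [h1], by simp [h1, h2], hmono _ _ _ _ (by simp) h3⟩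
  | call args res =>
    by_cases hT : c₂.time + 1 + totalLength (args.map c₂.regs) ≤ T
    · obtain ⟨h1, h2, h3⟩ := h (by omega)
      have := hO _ _ _ _ hT h3
      simp only [Prog.run, h1]
      refine this.bind fun a b hab => .pure fun _ => ?_
      refine ⟨by simp [hab.1], by simp [h2], ?_⟩
      simpa [Nat.add_assoc] using hab.2
    · refine (Coupled.product _ _).bind fun a b _ => .pure fun hT' => absurd ?_ hT
      simp at hT'
      omega
  | seq p q ihp ihq => exact (ihp h).bind fun a b hab => ihq hab
  | ifTop r b p q ihp ihq =>
    by_cases hT : c₂.time ≤ T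
    · obtain ⟨h1, h2, h3⟩ := h hT
      simp only [Prog.run, h1]
      split_ifs
      · exact ihp fun _ => ⟨h1, by simp [h2], hmono _ _ _ _ (by simp) h3⟩
      · exact ihq fun _ => ⟨h1, by simp [h2], hmono _ _ _ _ (by simp) h3⟩
    · exact triv _ _ _ hT
  | loop r p ih =>
    by_cases hT : c₂.time ≤ T
    · obtain ⟨h1, h2, h3⟩ := h hT
      simp only [Prog.run, h1]
      exact repeatM_coupled (fun a b hab => ih hab) _
        fun _ => ⟨h1, by simp [h2], hmono _ _ _ _ (by simp) h3⟩
    · exact triv _ _ _ hT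

end Run

/-! ### Polynomial bounds -/

theorem poly_eval_mono (f : Polynomial ℕ) : Monotone fun m => f.eval m := by
  intro a b hab
  simp only [Polynomial.eval_eq_sum_range]
  gcongr

/-- The base is at least `2`, so coefficients are absorbed by a larger exponent (`a ≤ 2 ^ a`), also
at `m = 0`. Pure powers are needed because nested loops can compute them in unary. -/
theorem exists_poly_le_pow (f : Polynomial ℕ) : ∃ k, ∀ m, f.eval m ≤ (m + 2) ^ k := by
  induction f using Polynomial.induction_on' with
  | add p q hp hq =>
    obtain ⟨a, ha⟩ := hp
    obtain ⟨b, hb⟩ := hq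
    refine ⟨max a b + 1, fun m => ?_⟩
    have h1 : (m + 2) ^ a ≤ (m + 2) ^ max a b := Nat.pow_le_pow_right (by omega) (le_max_left _ _)
    have h2 : (m + 2) ^ b ≤ (m + 2) ^ max a b := Nat.pow_le_pow_right (by omega) (le_max_right _ _)
    have h3 := ha m
    have h4 := hb m
    rw [Polynomial.eval_add, pow_succ]
    nlinarith
  | monomial n a =>
    refine ⟨a + n, fun m => ?_⟩
    rw [Polynomial.eval_monomial, pow_add]
    refine Nat.mul_le_mul ?_ (Nat.pow_le_pow_left (by omega) _)
    exact (Nat.lt_two_pow_self (n := a)).le.trans (Nat.pow_le_pow_left (by omega) _)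

/-! ### Inlining a program into a block of registers -/

/-- All registers that the program mentions are below `m`. -/
def Prog.RegsLt (m : ℕ) : Prog → Prop
  | .skip => True
  | .push r _ => r < m
  | .pop r => r < m
  | .coin r => r < m
  | .move dst src => dst < m ∧ src < m
  | .copy dst src => dst < m ∧ src < m
  | .call args res => (∀ r ∈ args, r < m) ∧ res < m
  | .seq p q => p.RegsLt m ∧ q.RegsLt m
  | .ifTop r _ p q => r < m ∧ p.RegsLt m ∧ q.RegsLt m
  | .loop r p => r < m ∧ p.RegsLt m

theorem Prog.RegsLt.mono {m n : ℕ} (h : m ≤ n) : ∀ {p : Prog}, p.RegsLt m → p.RegsLt n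
  | .skip, _ => trivial
  | .push _ _, hp => lt_of_lt_of_le hp h
  | .pop _, hp => lt_of_lt_of_le hp h
  | .coin _, hp => lt_of_lt_of_le hp h
  | .move _ _, hp => ⟨hp.1.trans_le h, hp.2.trans_le h⟩
  | .copy _ _, hp => ⟨hp.1.trans_le h, hp.2.trans_le h⟩
  | .call _ _, hp => ⟨fun r hr => (hp.1 r hr).trans_le h, hp.2.trans_le h⟩
  | .seq _ _, hp => ⟨hp.1.mono h, hp.2.mono h⟩
  | .ifTop _ _ _ _, hp => ⟨hp.1.trans_le h, hp.2.1.mono h, hp.2.2.mono h⟩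
  | .loop _ _, hp => ⟨hp.1.trans_le h, hp.2.mono h⟩

theorem Prog.exists_regsLt (p : Prog) : ∃ m, p.RegsLt m := by
  induction p with
  | skip => exact ⟨0, trivial⟩
  | push r b => exact ⟨r + 1, Nat.lt_succ_self r⟩
  | pop r => exact ⟨r + 1, Nat.lt_succ_self r⟩
  | coin r => exact ⟨r + 1, Nat.lt_succ_self r⟩
  | move dst src => exact ⟨dst + src + 1, by constructor <;> omega⟩
  | copy dst src => exact ⟨dst + src + 1, by constructor <;> omega⟩
  | call args res =>
    refine ⟨args.sum + res + 1, fun r hr => ?_, by omega⟩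
    have := List.le_sum_of_mem hr
    omega
  | seq p q ihp ihq =>
    obtain ⟨a, ha⟩ := ihp
    obtain ⟨b, hb⟩ := ihq
    exact ⟨a + b, ha.mono (by omega), hb.mono (by omega)⟩
  | ifTop r b p q ihp ihq =>
    obtain ⟨a, ha⟩ := ihp
    obtain ⟨b, hb⟩ := ihq
    exact ⟨r + 1 + a + b, by omega, ha.mono (by omega), hb.mono (by omega)⟩
  | loop r p ih =>
    obtain ⟨a, ha⟩ := ih
    exact ⟨r + 1 + a, by omega, ha.mono (by omega)⟩

/-- The program moved to the registers `8 * r + k`, with its oracle calls replaced by the code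
that `h` provides for given arguments and result register. -/
def Prog.inline (k : ℕ) (h : List ℕ → ℕ → Prog) : Prog → Prog
  | .skip => .skip
  | .push r b => .push (8 * r + k) b
  | .pop r => .pop (8 * r + k)
  | .coin r => .coin (8 * r + k)
  | .move dst src => .move (8 * dst + k) (8 * src + k)
  | .copy dst src => .copy (8 * dst + k) (8 * src + k)
  | .call args res => h args res
  | .seq p q => .seq (p.inline k h) (q.inline k h)
  | .ifTop r b p q => .ifTop (8 * r + k) b (p.inline k h) (q.inline k h)
  | .loop r p => .loop (8 * r + k) (p.inline k h)

section Inline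

variable {σ τ : Type}

/-- The inlined program simulates the original one, if the code for the calls simulates the
oracle; the running time grows at most by a factor that bounds the running time of that code. -/
theorem inline_coupled {O : Oracle σ} {O' : Oracle τ} {k m T F K : ℕ} {h : List ℕ → ℕ → Prog}
    {Inv : Cfg σ → τ → Prop} (hF : 1 ≤ F)
    (hInv : ∀ c c' s, c'.env = c.env → (∀ r, (∀ j, r ≠ 8 * j + k) → c'.regs r = c.regs r) →
      Inv c s → Inv c' s)
    (hh : ∀ (c : Cfg σ) (s : τ) (args : List ℕ) (res : ℕ), res < m → Inv c s →
      totalLength (args.map fun r => c.regs (8 * r + k)) ≤ T →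
      Coupled (fun c' a => c'.regs (8 * res + k) = a.1 ∧
          (∀ r, r ≠ res → c'.regs (8 * r + k) = c.regs (8 * r + k)) ∧
          Inv c' a.2 ∧ c'.time ≤ c.time + F)
        ((h args res).run O c) (O' (args.map fun r => c.regs (8 * r + k)) s))
    {p : Prog} (hp : p.RegsLt m) {c : Cfg σ} {d : Cfg τ}
    (hcd : d.time ≤ T → (∀ r < m, c.regs (8 * r + k) = d.regs r) ∧ Inv c d.env ∧
      c.time ≤ K + F * d.time) :
    Coupled (fun c d => d.time ≤ T → (∀ r < m, c.regs (8 * r + k) = d.regs r) ∧ Inv c d.env ∧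
      c.time ≤ K + F * d.time) ((p.inline k h).run O c) (p.run O' d) := by
  have hset : ∀ {c : Cfg σ} {d : Cfg τ} (r : ℕ) (w : Word) (t t' : ℕ), r < m → t ≤ F * t' →
      ((∀ r < m, c.regs (8 * r + k) = d.regs r) ∧ Inv c d.env ∧ c.time ≤ K + F * d.time) →
      (∀ s < m, ((c.set (8 * r + k) w).tick t).regs (8 * s + k) = ((d.set r w).tick t').regs s) ∧
      Inv ((c.set (8 * r + k) w).tick t) ((d.set r w).tick t').env ∧
      ((c.set (8 * r + k) w).tick t).time ≤ K + F * ((d.set r w).tick t').time := by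
    intro c d r w t t' hr ht hcd
    obtain ⟨h1, h2, h3⟩ := hcd
    refine ⟨fun s hs => ?_, hInv c _ _ rfl (fun r' hr' => ?_) h2, ?_⟩
    · simp only [Cfg.tick_regs, Cfg.set_regs, Function.update_apply]
      by_cases hrs : s = r
      · subst hrs; simp
      · rw [if_neg (by omega), if_neg hrs, h1 s hs]
    · simp [Function.update_of_ne (hr' r)]
    · simp only [Cfg.tick_time, Cfg.set_time, Nat.mul_add]; omega
  have htick : ∀ {c : Cfg σ} {d : Cfg τ} (t : ℕ),
      ((∀ r < m, c.regs (8 * r + k) = d.regs r) ∧ Inv c d.env ∧ c.time ≤ K + F * d.time) →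
      (∀ s < m, (c.tick t).regs (8 * s + k) = (d.tick t).regs s) ∧
      Inv (c.tick t) (d.tick t).env ∧ (c.tick t).time ≤ K + F * (d.tick t).time := by
    intro c d t hcd
    refine ⟨hcd.1, hInv c _ _ rfl (fun _ _ => rfl) hcd.2.1, ?_⟩
    have := hcd.2.2
    have := Nat.le_mul_of_pos_left t hF
    simp only [Cfg.tick_time, Nat.mul_add]; omega
  have triv : ∀ (p p' : Prog) (c : Cfg σ) (d : Cfg τ), ¬ d.time ≤ T →
      Coupled (fun c d => d.time ≤ T → (∀ r < m, c.regs (8 * r + k) = d.regs r) ∧ Inv c d.env ∧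
      c.time ≤ K + F * d.time) (p'.run O c) (p.run O' d) := fun p p' c d hT =>
    (Coupled.product _ _).mono fun a b hab hb =>
      absurd ((le_time_of_mem_run p hab.2).trans hb) hT
  induction p generalizing c d with
  | skip => exact .pure fun hT => htick 1 (hcd (by simp at hT; omega))
  | push r b =>
    refine .pure fun hT => ?_
    have hcd := hcd (by simp at hT; omega)
    simp only [Prog.RegsLt] at hp
    rw [hcd.1 r hp]
    exact hset r _ 1 1 hp (by omega) hcd
  | pop r =>
    refine .pure fun hT => ?_
    have hcd := hcd (by simp at hT; omega)
    simp only [Prog.RegsLt] at hp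
    rw [hcd.1 r hp]
    exact hset r _ 1 1 hp (by omega) hcd
  | coin r =>
    refine (Coupled.refl _).bind ?_
    rintro b _ rfl
    refine .pure fun hT => ?_
    have hcd := hcd (by simp at hT; omega)
    simp only [Prog.RegsLt] at hp
    rw [hcd.1 r hp]
    exact hset r _ 1 1 hp (by omega) hcd
  | move dst src =>
    refine .pure fun hT => ?_
    have hcd := hcd (by simp at hT; omega)
    simp only [Prog.RegsLt] at hp
    rw [hcd.1 src hp.2]
    -- A move is two assignments, of which the first is free of charge.
    exact hset dst _ 1 1 hp.1 (by omega) (hset src [] 0 0 hp.2 (by omega) hcd)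
  | copy dst src =>
    refine .pure fun hT => ?_
    have hcd := hcd (by simp at hT; omega)
    simp only [Prog.RegsLt] at hp
    rw [hcd.1 src hp.2]
    exact hset dst _ _ _ hp.1 (Nat.le_mul_of_pos_left _ hF) hcd
  | call args res =>
    obtain ⟨hargs, hres⟩ := hp
    by_cases hT : d.time + 1 + totalLength (args.map d.regs) ≤ T
    · obtain ⟨h1, h2, h3⟩ := hcd (by omega)
      have hm : (args.map fun r => c.regs (8 * r + k)) = args.map d.regs :=
        List.map_congr_left fun r hr => h1 r (hargs r hr)
      have := hh c d.env args res hres h2 (by rw [hm]; omega)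
      rw [hm] at this
      refine this.map_right (g := fun a => (({ d with env := a.2 } : Cfg τ).set res a.1).tick
        (1 + totalLength (args.map d.regs))) ?_
      rintro c' a ⟨g1, g2, g3, g4⟩ -
      refine ⟨fun r hr => ?_, g3, ?_⟩
      · simp only [Cfg.tick_regs, Cfg.set_regs, Function.update_apply]
        split_ifs with hrr
        · rw [hrr, g1]
        · rw [g2 r hrr, h1 r hr]
      · simp only [Cfg.tick_time, Cfg.set_time, Nat.mul_add]
        have := Nat.zero_le (F * totalLength (args.map d.regs))
        omega
    · refine (Coupled.product _ _).mono fun a b hab hb => absurd ?_ hT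
      obtain ⟨-, hb'⟩ := hab
      obtain ⟨e, -, he⟩ := (PMF.mem_support_bind_iff _ _ _).1 hb'
      simp only [PMF.support_pure, Set.mem_singleton_iff] at he
      subst he
      simp at hb
      omega
  | seq p q ihp ihq => exact (ihp hp.1 hcd).bind fun a b hab => ihq hp.2 hab
  | ifTop r b p q ihp ihq =>
    by_cases hT : d.time ≤ T
    · obtain ⟨hr, hp, hq⟩ := hp
      have hcd := hcd hT
      simp only [Prog.run, Prog.inline, hcd.1 r hr]
      split_ifs
      · exact ihp hp fun _ => htick 1 hcd
      · exact ihq hq fun _ => htick 1 hcd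
    · exact triv (.ifTop r b p q) _ _ _ hT
  | loop r p ih =>
    by_cases hT : d.time ≤ T
    · obtain ⟨hr, hp⟩ := hp
      have hcd := hcd hT
      simp only [Prog.run, Prog.inline, hcd.1 r hr]
      exact repeatM_coupled (fun a b hab => ih hp hab) _ fun _ => htick _ hcd
    · exact triv (.loop r p) _ _ _ hT

end Inline

/-! ### Deterministic pieces of code -/

section Deterministic

variable {σ : Type}

/-- The run of `p` from `c` is deterministic and ends in a configuration that satisfies `P`. -/
def Reaches (O : Oracle σ) (p : Prog) (c : Cfg σ) (P : Cfg σ → Prop) : Prop :=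
  ∃ c', p.run O c = PMF.pure c' ∧ P c'

variable {O : Oracle σ} {p q : Prog} {c : Cfg σ} {P Q : Cfg σ → Prop}

theorem Reaches.mono (h : Reaches O p c P) (hPQ : ∀ c', P c' → Q c') : Reaches O p c Q :=
  let ⟨c', h1, h2⟩ := h
  ⟨c', h1, hPQ c' h2⟩

theorem Reaches.seq (h : Reaches O p c P) (hq : ∀ c', P c' → Reaches O q c' Q) :
    Reaches O (.seq p q) c Q := by
  obtain ⟨c', h1, h2⟩ := h
  obtain ⟨c'', h3, h4⟩ := hq c' h2
  exact ⟨c'', by rw [Prog.run, h1, PMF.pure_bind, h3], h4⟩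

theorem Reaches.seq_coupled {β : Type} {R : Cfg σ → β → Prop} {ν : PMF β}
    (h : Reaches O p c P) (hq : ∀ c', P c' → Coupled R (q.run O c') ν) :
    Coupled R ((Prog.seq p q).run O c) ν := by
  obtain ⟨c', h1, h2⟩ := h
  rw [Prog.run, h1, PMF.pure_bind]
  exact hq c' h2

theorem Reaches.coupled {β : Type} {R : Cfg σ → β → Prop} {b : β}
    (h : Reaches O p c fun c' => R c' b) : Coupled R (p.run O c) (PMF.pure b) := by
  obtain ⟨c', h1, h2⟩ := h
  rw [h1]
  exact .pure h2

theorem Reaches.ifTop_pos {r : ℕ} {b : Option Bool} (h : (c.regs r).head? = b)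
    (hp : Reaches O p (c.tick 1) P) : Reaches O (.ifTop r b p q) c P := by
  obtain ⟨c', h1, h2⟩ := hp
  exact ⟨c', by rw [Prog.run, if_pos h, h1], h2⟩

theorem Reaches.ifTop_neg {r : ℕ} {b : Option Bool} (h : (c.regs r).head? ≠ b)
    (hq : Reaches O q (c.tick 1) P) : Reaches O (.ifTop r b p q) c P := by
  obtain ⟨c', h1, h2⟩ := hq
  exact ⟨c', by rw [Prog.run, if_neg h, h1], h2⟩

theorem reaches_move (dst src : ℕ) (h : dst ≠ src) : Reaches O (.move dst src) c fun c' =>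
    c'.regs dst = c.regs src ∧ c'.regs src = [] ∧
    (∀ r, r ≠ dst → r ≠ src → c'.regs r = c.regs r) ∧ c'.env = c.env ∧
    c'.time = c.time + 1 := by
  refine ⟨_, rfl, ?_, ?_, ?_, rfl, rfl⟩
  · simp
  · simp [Function.update_of_ne h.symm]
  · intro r h1 h2; simp [Function.update_of_ne h1, Function.update_of_ne h2]

theorem reaches_copy (dst src : ℕ) : Reaches O (.copy dst src) c fun c' =>
    c'.regs dst = c.regs src ∧ (∀ r, r ≠ dst → c'.regs r = c.regs r) ∧ c'.env = c.env ∧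
    c'.time = c.time + 1 + (c.regs src).length := by
  refine ⟨_, rfl, ?_, ?_, rfl, (Nat.add_assoc _ _ _).symm⟩
  · simp
  · intro r h1; simp [Function.update_of_ne h1]

theorem reaches_push (r : ℕ) (b : Bool) : Reaches O (.push r b) c fun c' =>
    c'.regs r = b :: c.regs r ∧ (∀ s, s ≠ r → c'.regs s = c.regs s) ∧ c'.env = c.env ∧
    c'.time = c.time + 1 := by
  refine ⟨_, rfl, ?_, ?_, rfl, rfl⟩
  · simp
  · intro s h1; simp [Function.update_of_ne h1]

theorem reaches_pop (r : ℕ) : Reaches O (.pop r) c fun c' =>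
    c'.regs r = (c.regs r).tail ∧ (∀ s, s ≠ r → c'.regs s = c.regs s) ∧ c'.env = c.env ∧
    c'.time = c.time + 1 := by
  refine ⟨_, rfl, ?_, ?_, rfl, rfl⟩
  · simp
  · intro s h1; simp [Function.update_of_ne h1]

/-- An invariant indexed by the round of a loop. -/
theorem reaches_loop {r : ℕ} {I : ℕ → Cfg σ → Prop} (h0 : I 0 (c.tick (1 + (c.regs r).length)))
    (hstep : ∀ i c', i < (c.regs r).length → I i c' → Reaches O p c' (I (i + 1))) :
    Reaches O (.loop r p) c (I (c.regs r).length) := by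
  have key : ∀ n ≤ (c.regs r).length, ∃ c',
      repeatM (p.run O) n (c.tick (1 + (c.regs r).length)) = PMF.pure c' ∧ I n c' := by
    intro n hn
    induction n with
    | zero => exact ⟨_, rfl, h0⟩
    | succ n ih =>
      obtain ⟨c', h1, h2⟩ := ih (by omega)
      obtain ⟨c'', h3, h4⟩ := hstep n c' (by omega) h2
      exact ⟨c'', by rw [repeatM_succ_right, h1, PMF.pure_bind, h3], h4⟩
  exact key _ le_rfl

/-- Empty the registers `8 * r + k`, `r < m`. Register `8` serves as a dustbin. -/
def clearBlock (k : ℕ) : ℕ → Prog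
  | 0 => .skip
  | m + 1 => .seq (clearBlock k m) (.move 8 (8 * m + k))

/-- A move takes one step however long the string is, so the cost does not depend on what the block
contains. The condition on `k` keeps the dustbin outside the block. -/
theorem reaches_clearBlock {k : ℕ} (hk : k % 8 ≠ 0) (m : ℕ) :
    Reaches O (clearBlock k m) c fun c' => (∀ r < m, c'.regs (8 * r + k) = []) ∧
      (∀ r, r ≠ 8 → (∀ j, r ≠ 8 * j + k) → c'.regs r = c.regs r) ∧ c'.env = c.env ∧
      c'.time = c.time + m + 1 := by
  induction m with
  | zero => exact ⟨_, rfl, by simp, by simp, rfl, rfl⟩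
  | succ m ih =>
    refine ih.seq fun c' ⟨h1, h2, h3, h4⟩ => (reaches_move _ _ (by omega)).mono ?_
    rintro c'' ⟨g1, g2, g3, g4, g5⟩
    refine ⟨fun r hr => ?_, fun r h8 hr => ?_, g4.trans h3, by omega⟩
    · by_cases hrm : r = m
      · rw [hrm, g2]
      · rw [g3 _ (by omega) (by omega), h1 r (by omega)]
    · rw [g3 _ h8 (hr m), h2 r h8 hr]

/-- Copy the `i`-th argument of a call from block `k` to `dst`. -/
def copyArg (k : ℕ) (args : List ℕ) (i dst : ℕ) : Prog :=
  match args[i]? with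
  | some r => .copy dst (8 * r + k)
  | none => .move 8 dst

theorem length_getD_le_totalLength (l : List Word) (i : ℕ) :
    (l.getD i []).length ≤ totalLength l := by
  induction l generalizing i with
  | nil => simp
  | cons a l ih =>
    cases i with
    | zero => simp [totalLength]
    | succ i => have := ih i; simp [totalLength] at *; omega

/-- A missing argument is read as the empty string, which agrees with the default value in the
definitions of the oracles. -/
theorem reaches_copyArg (k : ℕ) (args : List ℕ) (i dst : ℕ) (hdst : dst ≠ 8) :
    Reaches O (copyArg k args i dst) c fun c' =>
      c'.regs dst = (args.map fun r => c.regs (8 * r + k)).getD i [] ∧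
      (∀ r, r ≠ dst → r ≠ 8 → c'.regs r = c.regs r) ∧ c'.env = c.env ∧
      c'.time ≤ c.time + 1 + totalLength (args.map fun r => c.regs (8 * r + k)) := by
  have hl := length_getD_le_totalLength (args.map fun r => c.regs (8 * r + k)) i
  unfold copyArg
  cases h : args[i]? with
  | none =>
    refine (reaches_move _ _ hdst.symm).mono ?_
    rintro c' ⟨h1, h2, h3, h4, h5⟩
    refine ⟨?_, fun r a b => h3 r b a, h4, by omega⟩
    rw [h2]; simp [List.getD_eq_getElem?_getD, h]
  | some r =>
    have hr : (args.map fun r => c.regs (8 * r + k)).getD i [] = c.regs (8 * r + k) := by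
      simp [List.getD_eq_getElem?_getD, h]
    rw [hr] at hl ⊢
    refine (reaches_copy _ _).mono ?_
    rintro c' ⟨h1, h2, h3, h4⟩
    exact ⟨h1, fun s a _ => h2 s a, h3, by omega⟩

end Deterministic

/-! ### The registers of the reduction

Block `1` holds the adversary, block `2` the simulator and block `3` the algorithms of the proof
system; the registers divisible by `8` are global. -/

local notation "rN" => (16 : ℕ)
local notation "rPP" => (24 : ℕ)
local notation "rIdx" => (32 : ℕ)
local notation "rFlag" => (40 : ℕ)
local notation "rX" => (48 : ℕ)
local notation "rW" => (56 : ℕ)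
local notation "rPi" => (64 : ℕ)
local notation "rSt" => (72 : ℕ)
local notation "rRes" => (80 : ℕ)
local notation "rMsg" => (88 : ℕ)
local notation "rLen" => (96 : ℕ)
local notation "rNum" => (104 : ℕ)
local notation "rBase" => (112 : ℕ)
local notation "rHalf" => (120 : ℕ)
local notation "rPar" => (128 : ℕ)
local notation "rCoin" => (136 : ℕ)
local notation "rTmp" => (144 : ℕ)
local notation "rPk" => (152 : ℕ)

/-! ### Running an algorithm without oracle as a subroutine -/

theorem ofInputs_length_le (inputs : List Word) (r : ℕ) :
    (Regs.ofInputs inputs r).length ≤ totalLength inputs :=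
  length_getD_le_totalLength inputs r

theorem length_le_of_mem_out {p : Prog} {inputs : List Word} {T : ℕ} (hp : p.TimeBound inputs T)
    {w : Word} (hw : w ∈ (p.out inputs).support) : w.length ≤ totalLength inputs + T := by
  obtain ⟨c, hc, rfl⟩ := (PMF.mem_support_map_iff _ _ _).1 hw
  have hT := hp _ _ _ c hc
  have := length_le_of_mem_run (O := noOracle) (L := totalLength inputs) (T := T)
    (fun args s _ a ha => by
      simp only [noOracle, PMF.support_pure, Set.mem_singleton_iff] at ha
      simp [ha]) p (fun r => by simpa [Cfg.start] using ofInputs_length_le inputs r) hc hT 0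
  omega

/-- Run `p` on the contents of the registers `a`, `b`, `d` and store its output in `dst`. -/
def subroutine (m : ℕ) (p : Prog) (a b d dst : ℕ) : Prog :=
  .seq (clearBlock 3 m) <| .seq (.copy 3 a) <| .seq (.copy 11 b) <| .seq (.copy 19 d) <|
    .seq (p.inline 3 fun _ res => .move 8 (8 * res + 3)) (.move dst 3)

section

variable {σ : Type}

/-- The block is cleared first because it may hold remains of an earlier subroutine; after that the
registers `3`, `11`, `19` are the inputs `0`, `1`, `2` of the inlined program, and `inline_coupled`
applies. The register `dst` may coincide with one of the arguments. -/
theorem subroutine_coupled {O : Oracle σ} {m T : ℕ} {p : Prog} (hm : 1 ≤ m) (hp : p.RegsLt m)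
    {a b d dst : ℕ} (ha : a % 8 = 0) (hb : b % 8 = 0) (hd : d % 8 = 0) (hdst : dst % 8 = 0)
    (ha' : a ≠ 8) (hb' : b ≠ 8) (hd' : d ≠ 8) {c : Cfg σ} {u v w : Word}
    (hu : c.regs a = u) (hv : c.regs b = v) (hw : c.regs d = w) (hT : p.TimeBound [u, v, w] T) :
    Coupled (fun c' z => c'.regs dst = z ∧ z.length ≤ totalLength [u, v, w] + T ∧
        c'.env = c.env ∧ (∀ r, r % 8 ≠ 3 → r ≠ 8 → r ≠ dst → c'.regs r = c.regs r) ∧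
        c'.time ≤ c.time + (m + 5 + totalLength [u, v, w] + T))
      ((subroutine m p a b d dst).run O c) (p.out [u, v, w]) := by
  unfold subroutine
  refine (reaches_clearBlock (by omega) m).seq_coupled ?_
  rintro c1 ⟨z1, f1, e1, t1⟩
  refine (reaches_copy _ _).seq_coupled ?_
  rintro c2 ⟨z2, f2, e2, t2⟩
  refine (reaches_copy _ _).seq_coupled ?_
  rintro c3 ⟨z3, f3, e3, t3⟩
  refine (reaches_copy _ _).seq_coupled ?_
  rintro c4 ⟨z4, f4, e4, t4⟩
  have x1 : c1.regs a = u := by rw [f1 a ha' (by omega), hu]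
  have x2 : c2.regs b = v := by rw [f2 b (by omega), f1 b hb' (by omega), hv]
  have x3 : c3.regs d = w := by
    rw [f3 d (by omega), f2 d (by omega), f1 d hd' (by omega), hw]
  have frame : ∀ r, r % 8 ≠ 3 → r ≠ 8 → c4.regs r = c.regs r := fun r hr h8 => by
    rw [f4 r (by omega), f3 r (by omega), f2 r (by omega), f1 r h8 (by omega)]
  have hmatch : ∀ r < m, c4.regs (8 * r + 3) = Regs.ofInputs [u, v, w] r := by
    intro r hr
    match r, hr with
    | 0, _ => rw [f4 _ (by omega), f3 _ (by omega)]; exact z2.trans x1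
    | 1, _ => rw [f4 _ (by omega)]; exact z3.trans x2
    | 2, _ => exact z4.trans x3
    | r + 3, hr =>
      rw [f4 _ (by omega), f3 _ (by omega), f2 _ (by omega), z1 _ hr]; simp [Regs.ofInputs]
  -- The absent oracle answers with the empty string, so a call is simulated by emptying the result
  -- register.
  have sim := inline_coupled (O := O) (O' := noOracle) (k := 3) (m := m) (T := T) (F := 1)
    (K := c4.time) (h := fun _ res => .move 8 (8 * res + 3))
    (Inv := fun c' _ => c'.env = c.env ∧ ∀ r, r % 8 ≠ 3 → r ≠ 8 → c'.regs r = c.regs r)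
    le_rfl
    (fun c c' _ he hr h => ⟨he.trans h.1, fun r h3 h8 =>
      (hr r (by omega)).trans (h.2 r h3 h8)⟩)
    (fun c' s args res _ hI _ => by
      refine Reaches.coupled ((reaches_move _ _ (by omega)).mono ?_)
      rintro c'' ⟨-, g2, g3, g4, g5⟩
      exact ⟨g2, fun r hr => g3 _ (by omega) (by omega), ⟨g4.trans hI.1, fun r h3 h8 =>
        (g3 r h8 (by omega)).trans (hI.2 r h3 h8)⟩, g5.le⟩)
    hp (c := c4) (d := Cfg.start [u, v, w] ()) fun _ =>
      ⟨hmatch, ⟨by rw [e4, e3, e2, e1], frame⟩, by simp [Cfg.start]⟩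
  refine Coupled.bind_left (R := fun c' z => c'.regs 3 = z ∧
    z.length ≤ totalLength [u, v, w] + T ∧ c'.env = c.env ∧
    (∀ r, r % 8 ≠ 3 → r ≠ 8 → c'.regs r = c.regs r) ∧ c'.time ≤ c4.time + T) ?_ ?_
  · have := (sim.mono_support (S := fun c' d => c'.regs 3 = d.regs 0 ∧ c'.env = c.env ∧
      (∀ r, r % 8 ≠ 3 → r ≠ 8 → c'.regs r = c.regs r) ∧ c'.time ≤ c4.time + T) ?_).map_right
      (g := fun d => d.regs 0)
      (S := fun c' z => c'.regs 3 = z ∧ c'.env = c.env ∧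
      (∀ r, r % 8 ≠ 3 → r ≠ 8 → c'.regs r = c.regs r) ∧ c'.time ≤ c4.time + T)
      (fun _ _ h => h)
    · refine Coupled.mono_support this ?_
      rintro c' z ⟨h1, h2, h3, h4⟩ - hz
      exact ⟨h1, length_le_of_mem_out hT hz, h2, h3, h4⟩
    · rintro c' d' h - hd'
      -- The time bound of the original program removes the condition on the clock.
      have hdT := hT _ _ _ d' hd'
      obtain ⟨h1, h2, h3⟩ := h hdT
      exact ⟨h1 0 hm, h2.1, h2.2, by omega⟩
  · rintro c' z ⟨h1, h2, h3, h4, h5⟩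
    refine Reaches.coupled ((reaches_move _ _ (by omega)).mono ?_)
    rintro c'' ⟨g1, -, g3, g4, g5⟩
    refine ⟨g1.trans h1, h2, g4.trans h3, fun r hr h8 hrd => ?_, ?_⟩
    · rw [g3 r hrd (by omega), h4 r hr h8]
    · rw [x1] at t2; rw [x2] at t3; rw [x3] at t4
      simp only [totalLength, List.map_cons, List.map_nil, List.sum_cons, List.sum_nil]
      omega

/-! ### The prover in the reduction -/

/-- The prover of the reduction, with a counter, a flag and the state of the challenge oracle `O`
as its state: while the counter is positive, proofs are randomized; the next one is submitted as
the challenge; all later ones are fresh. -/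
def NIZK.gameProver (N : NIZK) (O : Oracle σ) (pp : Word) : Oracle (ℕ × Bool × σ) := fun args s =>
  let x := args.getD 0 []
  let w := args.getD 1 []
  if N.rel pp x w = true then
    (N.prove.out [pp, x, w]).bind fun π =>
      if 0 < s.1 then (N.rand.out [pp, x, π]).map fun π' => (π', (s.1 - 1, s.2))
      else if s.2.1 = false then (O [x, w, π] s.2.2).map fun a => (a.1, (s.1, true, a.2))
      else PMF.pure (π, s)
  else PMF.pure ([], s)

/-- The code for a call of the prover by the simulator. -/
def proverCode (N : NIZK) (m : ℕ) (args : List ℕ) (res : ℕ) : Prog :=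
  .seq (copyArg 2 args 0 rX) <| .seq (copyArg 2 args 1 rW) <|
  .seq (subroutine m N.decideRel rPP rX rW rPi) <|
  .seq (.ifTop rPi (some true)
      (.seq (subroutine m N.prove rPP rX rW rPi)
        (.ifTop rIdx none
          (.ifTop rFlag none (.seq (.push rFlag true) (.call [rX, rW, rPi] rPi)) .skip)
          (.seq (.pop rIdx) (subroutine m N.rand rPP rX rPi rPi))))
      (.move 8 rPi))
    (.move (8 * res + 2) rPi)

/-- The registers that must survive an activation of the simulator. -/
def Kept (r : ℕ) : Prop := r % 8 = 1 ∨ r = rN ∨ r = rPP ∨ r = rLen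

/-- The registers represent the state `s` of the prover; the surviving ones have the contents
`fr`. -/
structure Represents (fr : Regs) (c : Cfg σ) (s : ℕ × Bool × σ) : Prop where
  env : c.env = s.2.2
  idx : (c.regs rIdx).length = s.1
  flag : c.regs rFlag = if s.2.1 then [true] else []
  kept : ∀ r, Kept r → c.regs r = fr r

theorem Represents.of_frame {fr : Regs} {c c' : Cfg σ} {s : ℕ × Bool × σ}
    (h : Represents fr c s) (he : c'.env = c.env)
    (hr : ∀ r, (Kept r ∨ r = rIdx ∨ r = rFlag) → c'.regs r = c.regs r) : Represents fr c' s :=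
  ⟨he.trans h.env, by rw [hr _ (.inr (.inl rfl)), h.idx], by rw [hr _ (.inr (.inr rfl)), h.flag],
    fun r hk => (hr r (.inl hk)).trans (h.kept r hk)⟩

/-- All programs of the proof system respect the bound `m` on registers. -/
def NIZK.RegsLt (N : NIZK) (m : ℕ) : Prop :=
  N.decideRel.RegsLt m ∧ N.prove.RegsLt m ∧ N.rand.RegsLt m

/-- Calls of the prover are implemented correctly, at the cost `F`. -/
def ProverCost (N : NIZK) (m : ℕ) (F : Polynomial ℕ) : Prop :=
  ∀ (σ : Type) (O : Oracle σ) (fr : Regs) (c : Cfg σ) (s : ℕ × Bool × σ) (args : List ℕ)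
    (res : ℕ), Represents fr c s →
    Coupled (fun c' a => c'.regs (8 * res + 2) = a.1 ∧
        (∀ r, r ≠ res → c'.regs (8 * r + 2) = c.regs (8 * r + 2)) ∧ Represents fr c' a.2 ∧
        c'.time ≤ c.time +
          F.eval ((fr rPP).length + totalLength (args.map fun r => c.regs (8 * r + 2))))
      ((proverCode N m args res).run O c)
      (N.gameProver O (fr rPP) (args.map fun r => c.regs (8 * r + 2)) s)

/-- The code follows the case distinctions of `gameProver`, the counter being the length of `rIdx`.
The bound does not depend on the oracle: its answer may be long, but it is only moved. -/
theorem exists_proverCost (N : NIZK) {m : ℕ} (hm : 1 ≤ m) (hN : N.RegsLt m) :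
    ∃ F, ProverCost N m F := by
  obtain ⟨fd, hfd⟩ := N.decideRel_ppt
  obtain ⟨fp, hfp⟩ := N.prove_ppt
  obtain ⟨fr', hfr⟩ := N.rand_ppt
  obtain ⟨hRd, hRp, hRr⟩ := hN
  -- For `u` the length of the parameters plus that of the arguments, `2 * u` bounds the input of
  -- the prover, since statement and witness are each bounded by the total length of the arguments.
  -- Then `V` bounds the input of the randomization and the length of the challenge, which include a
  -- proof of length at most `2 * u + fp.eval (2 * u)`.
  let X2 : Polynomial ℕ := 2 * Polynomial.X
  let V : Polynomial ℕ := 2 * X2 + fp.comp X2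
  refine ⟨Polynomial.C (3 * m + 30) + 4 * X2 + fd.comp X2 + fp.comp X2 + V + fr'.comp V, ?_⟩
  intro σ O fr c s args res hc
  set ws := args.map fun r => c.regs (8 * r + 2) with hws
  set x := ws.getD 0 [] with hx
  set w := ws.getD 1 [] with hw
  set pp := fr rPP with hpp
  set u := pp.length + totalLength ws with hu
  set v := 2 * (2 * u) + fp.eval (2 * u) with hv
  have hcost : (Polynomial.C (3 * m + 30) + 4 * X2 + fd.comp X2 + fp.comp X2 + V +
      fr'.comp V).eval u = 3 * m + 30 + 4 * (2 * u) + fd.eval (2 * u) + fp.eval (2 * u) + v +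
      fr'.eval v := by
    simp [X2, V, hv, Polynomial.eval_comp]
  rw [hcost]
  have lx : x.length ≤ totalLength ws := length_getD_le_totalLength _ _
  have lw : w.length ≤ totalLength ws := length_getD_le_totalLength _ _
  have tot : ∀ a b d : Word, totalLength [a, b, d] = a.length + b.length + d.length := by
    intro a b d; simp [totalLength, Nat.add_assoc]
  have lin : totalLength [pp, x, w] ≤ 2 * u := by rw [tot]; omega
  -- the end of the code
  have last : ∀ (c' : Cfg σ) (a : Word × (ℕ × Bool × σ)), c'.regs rPi = a.1 →
      (∀ r, c'.regs (8 * r + 2) = c.regs (8 * r + 2)) → Represents fr c' a.2 →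
      c'.time + 1 ≤ c.time + (3 * m + 30 + 4 * (2 * u) + fd.eval (2 * u) + fp.eval (2 * u) + v +
      fr'.eval v) →
      Coupled (fun c' a => c'.regs (8 * res + 2) = a.1 ∧
        (∀ r, r ≠ res → c'.regs (8 * r + 2) = c.regs (8 * r + 2)) ∧ Represents fr c' a.2 ∧
        c'.time ≤ c.time + (3 * m + 30 + 4 * (2 * u) + fd.eval (2 * u) + fp.eval (2 * u) + v +
        fr'.eval v))
      ((Prog.move (8 * res + 2) rPi).run O c') (PMF.pure a) := by
    intro c' a h1 h2 h3 h4
    refine Reaches.coupled ((reaches_move _ _ (by omega)).mono ?_)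
    rintro c'' ⟨g1, g2, g3, g4, g5⟩
    refine ⟨g1.trans h1, fun r hr => ?_, h3.of_frame g4 fun r hr => ?_, by omega⟩
    · rw [g3 _ (by omega) (by omega), h2]
    · unfold Kept at hr
      exact g3 r (by omega) (by omega)
  unfold proverCode
  refine (reaches_copyArg 2 args 0 rX (by omega)).seq_coupled ?_
  rintro c1 ⟨x1, f1, e1, t1⟩
  rw [← hws, ← hx] at x1
  rw [← hws] at t1
  refine (reaches_copyArg 2 args 1 rW (by omega)).seq_coupled ?_
  rintro c2 ⟨x2, f2, e2, t2⟩
  have hws1 : (args.map fun r => c1.regs (8 * r + 2)) = ws :=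
    List.map_congr_left fun r _ => f1 _ (by omega) (by omega)
  rw [hws1, ← hw] at x2
  rw [hws1] at t2
  have y1 : c2.regs rX = x := by rw [f2 _ (by omega) (by omega), x1]
  have y2 : c2.regs rPP = pp := by
    rw [f2 _ (by omega) (by omega), f1 _ (by omega) (by omega)]
    exact hc.kept _ (.inr (.inr (.inl rfl)))
  have frame2 : ∀ r, r ≠ 8 → r ≠ rX → r ≠ rW → c2.regs r = c.regs r := fun r h1 h2 h3 => by
    rw [f2 r h3 h1, f1 r h2 h1]
  have sd := subroutine_coupled (O := O) hm hRd (a := rPP) (b := rX) (d := rW) (dst := rPi)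
    rfl rfl rfl rfl (by omega) (by omega) (by omega) (c := c2) y2 y1 x2 (hfd _)
  have mfd := poly_eval_mono fd lin
  have mfp := poly_eval_mono fp lin
  simp only at mfd mfp
  rw [N.decideRel_out] at sd
  -- The decision program has a deterministic output; a trivial bind on the ideal side gives its run
  -- a partner.
  have base : N.gameProver O pp ws s =
      (PMF.pure [N.rel pp x w]).bind fun _ => N.gameProver O pp ws s := by rw [PMF.pure_bind]
  rw [base]
  refine Coupled.bind_support sd ?_
  rintro c3 z ⟨z3, -, e3, f3, t3⟩ - hz
  simp only [PMF.support_pure, Set.mem_singleton_iff] at hz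
  subst hz
  have frame3 : ∀ r, r % 8 ≠ 3 → r ≠ 8 → r ≠ rX → r ≠ rW → r ≠ rPi → c3.regs r = c.regs r :=
    fun r h0 h1 h2 h3 h4 => by rw [f3 r h0 h1 h4, frame2 r h1 h2 h3]
  have rep3 : Represents fr c3 s := hc.of_frame (by rw [e3, e2, e1]) fun r hr => by
    unfold Kept at hr
    exact frame3 r (by omega) (by omega) (by omega) (by omega) (by omega)
  by_cases hrel : N.rel pp x w = true
  swap
  · have h1 : (c3.regs rPi).head? ≠ some true := by rw [z3]; simpa using hrel
    have h2 : N.gameProver O pp ws s = PMF.pure ([], s) := by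
      simp only [NIZK.gameProver, ← hx, ← hw, if_neg hrel]
    rw [h2]
    simp only [Prog.run, if_neg h1, PMF.pure_bind]
    refine last _ _ ?_ ?_ ?_ ?_
    · simp
    · intro r
      have a1 : 8 * r + 2 ≠ 8 := by omega
      have a2 : 8 * r + 2 ≠ rPi := by omega
      simp only [Cfg.tick_regs, Cfg.set_regs, Function.update_of_ne a1, Function.update_of_ne a2]
      exact frame3 _ (by omega) (by omega) (by omega) (by omega) (by omega)
    · refine rep3.of_frame rfl fun r hr => ?_
      unfold Kept at hr
      have a1 : r ≠ 8 := by omega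
      have a2 : r ≠ rPi := by omega
      simp only [Cfg.tick_regs, Cfg.set_regs, Function.update_of_ne a1, Function.update_of_ne a2]
    · simp only [Cfg.tick_time, Cfg.set_time]
      omega
  have h1 : (c3.regs rPi).head? = some true := by rw [z3]; simpa using hrel
  have h2 : N.gameProver O pp ws s = (N.prove.out [pp, x, w]).bind fun π =>
      if 0 < s.1 then (N.rand.out [pp, x, π]).map fun π' => (π', (s.1 - 1, s.2))
      else if s.2.1 = false then (O [x, w, π] s.2.2).map fun a => (a.1, (s.1, true, a.2))
      else PMF.pure (π, s) := by
    simp only [NIZK.gameProver, ← hx, ← hw, if_pos hrel]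
  rw [h2]
  have y3 : c3.regs rX = x := by rw [f3 _ (by omega) (by omega) (by omega), y1]
  have w3 : c3.regs rW = w := by rw [f3 _ (by omega) (by omega) (by omega), x2]
  have p3 : c3.regs rPP = pp := rep3.kept _ (.inr (.inr (.inl rfl)))
  have sp := subroutine_coupled (O := O) hm hRp (a := rPP) (b := rX) (d := rW) (dst := rPi)
    rfl rfl rfl rfl (by omega) (by omega) (by omega) (c := c3.tick 1) p3 y3 w3 (hfp _)
  simp only [Prog.run, if_pos h1, PMF.bind_bind]
  refine sp.bind ?_
  rintro c4 π ⟨z4, l4, e4, f4, t4⟩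
  simp only [Cfg.tick_regs, Cfg.tick_env, Cfg.tick_time] at f4 e4 t4
  have frame4 : ∀ r, r % 8 ≠ 3 → r ≠ 8 → r ≠ rX → r ≠ rW → r ≠ rPi → c4.regs r = c.regs r :=
    fun r h0 h1 h2 h3 h4 => by rw [f4 r h0 h1 h4, frame3 r h0 h1 h2 h3 h4]
  have rep4 : Represents fr c4 s := rep3.of_frame e4 fun r hr => by
    unfold Kept at hr
    exact f4 r (by omega) (by omega) (by omega)
  have y4 : c4.regs rX = x := by rw [f4 _ (by omega) (by omega) (by omega), y3]
  have w4 : c4.regs rW = w := by rw [f4 _ (by omega) (by omega) (by omega), w3]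
  have p4 : c4.regs rPP = pp := rep4.kept _ (.inr (.inr (.inl rfl)))
  have idx4 := rep4.idx
  by_cases hs : 0 < s.1
  · have h3 : (c4.regs rIdx).head? ≠ none := by
      intro h0
      rw [List.head?_eq_none_iff] at h0
      rw [h0] at idx4
      simp at idx4
      omega
    simp only [if_neg h3, if_pos hs, PMF.pure_bind]
    have lin2 : totalLength [pp, x, π] ≤ v := by
      have := tot pp x w
      have := tot pp x π
      omega
    have mfr := poly_eval_mono fr' lin2
    simp only at mfr
    have sr := subroutine_coupled (O := O) hm hRr (a := rPP) (b := rX) (d := rPi) (dst := rPi)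
      rfl rfl rfl rfl (by omega) (by omega) (by omega)
      (c := (((c4.tick 1).set rIdx (c4.regs rIdx).tail).tick 1)) (u := pp) (v := x) (w := π)
      (by simp [p4]) (by simp [y4]) (by simp [z4]) (hfr _)
    refine sr.bind (g := fun π' => PMF.pure (π', (s.1 - 1, s.2))) ?_
    rintro c5 π' ⟨z5, l5, e5, f5, t5⟩
    simp only [Cfg.tick_regs, Cfg.tick_env, Cfg.tick_time, Cfg.set_regs, Cfg.set_env,
      Cfg.set_time] at f5 e5 t5
    refine last _ _ z5 (fun r => ?_) ⟨by rw [e5, rep4.env], ?_, ?_, fun r hr => ?_⟩ (by omega)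
    · rw [f5 _ (by omega) (by omega) (by omega), Function.update_of_ne (by omega)]
      exact frame4 _ (by omega) (by omega) (by omega) (by omega) (by omega)
    · rw [f5 _ (by omega) (by omega) (by omega), Function.update_self]
      simp [idx4]
    · rw [f5 _ (by omega) (by omega) (by omega), Function.update_of_ne (by omega)]
      exact rep4.flag
    · have hr' := hr
      unfold Kept at hr'
      rw [f5 _ (by omega) (by omega) (by omega), Function.update_of_ne (by omega)]
      exact rep4.kept r hr
  have h3 : (c4.regs rIdx).head? = none := by
    rw [List.head?_eq_none_iff, ← List.length_eq_zero_iff]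
    omega
  simp only [if_pos h3, if_neg hs, Cfg.tick_regs]
  have flag4 := rep4.flag
  by_cases hb : s.2.1 = false
  · have h4 : (c4.regs rFlag).head? = none := by rw [flag4]; simp [hb]
    simp only [if_pos h4, if_pos hb, PMF.pure_bind, PMF.bind_bind]
    have hargs : ([rX, rW, rPi].map (((((c4.tick 1).tick 1).set rFlag
        (true :: c4.regs rFlag)).tick 1).regs)) = [x, w, π] := by
      simp [y4, w4, z4]
    have henv : (((((c4.tick 1).tick 1).set rFlag
        (true :: c4.regs rFlag)).tick 1).env) = s.2.2 := rep4.env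
    rw [hargs, henv]
    refine (Coupled.refl _).bind ?_
    rintro a _ rfl
    refine last _ _ ?_ (fun r => ?_) ⟨rfl, ?_, ?_, fun r hr => ?_⟩ ?_
    · simp
    · have a1 : 8 * r + 2 ≠ rPi := by omega
      have a2 : 8 * r + 2 ≠ rFlag := by omega
      simp only [Cfg.tick_regs, Cfg.set_regs, Function.update_of_ne a1, Function.update_of_ne a2]
      exact frame4 _ (by omega) (by omega) (by omega) (by omega) (by omega)
    · simp [idx4]
    · simp [flag4, hb]
    · have hr' := hr
      unfold Kept at hr'
      have a1 : r ≠ rPi := by omega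
      have a2 : r ≠ rFlag := by omega
      simp only [Cfg.tick_regs, Cfg.set_regs, Function.update_of_ne a1, Function.update_of_ne a2]
      exact rep4.kept r hr
    · have := tot pp x w
      have := tot x w π
      simp only [Cfg.tick_time, Cfg.set_time]
      omega
  · have h4 : (c4.regs rFlag).head? ≠ none := by
      rw [flag4]; simp only [Bool.not_eq_false] at hb; simp [hb]
    simp only [if_neg h4, if_neg hb, PMF.pure_bind]
    refine last _ _ z4 (fun r => ?_) (rep4.of_frame rfl fun _ _ => rfl) ?_
    · exact frame4 _ (by omega) (by omega) (by omega) (by omega) (by omega)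
    · simp only [Cfg.tick_time]
      omega

end

/-! ### Activations of the simulator and queries of the adversary in the reduction -/

section

variable {σ τ : Type}

/-- The code for an activation of the simulator, on the state in register `rSt` and the message in
register `rMsg`; the answer goes to register `rRes`. -/
def activationCode (N : NIZK) (m : ℕ) (code : Prog) : Prog :=
  .seq (clearBlock 2 m) <| .seq (.copy 2 rN) <| .seq (.copy 10 rPP) <| .seq (.move 18 rSt) <|
  .seq (.move 26 rMsg) <| .seq (code.inline 2 (proverCode N m)) <|
  .seq (.move rRes 2) (.move rSt 10)

/-- Each of the at most `T` steps of the simulator costs at most one prover call. State and message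
are moved rather than copied, so their lengths, which are not bounded, do not enter the cost. -/
theorem activationCode_coupled {N : NIZK} {m T n : ℕ} {F : Polynomial ℕ}
    (hF : ProverCost N m F) (hm : 2 ≤ m) {code : Prog} (hcode : code.RegsLt m) {O : Oracle σ}
    {fr : Regs} {c : Cfg σ} {s : ℕ × Bool × σ} (hc : Represents fr c s) {pp st msg : Word}
    (hn : fr rN = unary n) (hpp : fr rPP = pp) (hst : c.regs rSt = st) (hmsg : c.regs rMsg = msg)
    (hT : code.TimeBound [unary n, pp, st, msg] T) :
    Coupled (fun c' d => c'.regs rRes = d.regs 0 ∧ c'.regs rSt = d.regs 1 ∧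
        Represents fr c' d.env ∧
        c'.time ≤ c.time + (m + 10 + n + pp.length + (F.eval (pp.length + T) + 1) * T))
      ((activationCode N m code).run O c)
      (code.run (N.gameProver O pp) (Cfg.start [unary n, pp, st, msg] s)) := by
  unfold activationCode
  refine (reaches_clearBlock (by omega) m).seq_coupled ?_
  rintro c1 ⟨z1, f1, e1, t1⟩
  refine (reaches_copy _ _).seq_coupled ?_
  rintro c2 ⟨z2, f2, e2, t2⟩
  refine (reaches_copy _ _).seq_coupled ?_
  rintro c3 ⟨z3, f3, e3, t3⟩
  refine (reaches_move _ _ (by omega)).seq_coupled ?_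
  rintro c4 ⟨z4, -, f4, e4, t4⟩
  refine (reaches_move _ _ (by omega)).seq_coupled ?_
  rintro c5 ⟨z5, -, f5, e5, t5⟩
  have x1 : c1.regs rN = unary n := by
    rw [f1 _ (by omega) (by omega), hc.kept _ (.inr (.inl rfl)), hn]
  have x2 : c2.regs rPP = pp := by
    rw [f2 _ (by omega), f1 _ (by omega) (by omega), hc.kept _ (.inr (.inr (.inl rfl))), hpp]
  have x3 : c3.regs rSt = st := by
    rw [f3 _ (by omega), f2 _ (by omega), f1 _ (by omega) (by omega), hst]
  have x4 : c4.regs rMsg = msg := by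
    rw [f4 _ (by omega) (by omega), f3 _ (by omega), f2 _ (by omega),
      f1 _ (by omega) (by omega), hmsg]
  have hmatch : ∀ r < m, c5.regs (8 * r + 2) = Regs.ofInputs [unary n, pp, st, msg] r := by
    intro r hr
    match r, hr with
    | 0, _ =>
      rw [f5 _ (by omega) (by omega), f4 _ (by omega) (by omega), f3 _ (by omega)]
      exact z2.trans x1
    | 1, _ =>
      rw [f5 _ (by omega) (by omega), f4 _ (by omega) (by omega)]
      exact z3.trans x2
    | 2, _ =>
      rw [f5 _ (by omega) (by omega)]
      exact z4.trans x3
    | 3, _ => exact z5.trans x4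
    | r + 4, hr =>
      rw [f5 _ (by omega) (by omega), f4 _ (by omega) (by omega), f3 _ (by omega),
        f2 _ (by omega), z1 _ hr]
      simp [Regs.ofInputs]
  have rep5 : Represents fr c5 s := hc.of_frame (by rw [e5, e4, e3, e2, e1]) fun r hr => by
    unfold Kept at hr
    rw [f5 _ (by omega) (by omega), f4 _ (by omega) (by omega), f3 _ (by omega),
      f2 _ (by omega), f1 _ (by omega) (by omega)]
  -- Sending arguments costs their length, so within `T` steps no call has arguments longer than
  -- `T`; this bounds the cost of a single call.
  have sim := inline_coupled (O := O) (O' := N.gameProver O pp) (k := 2) (m := m) (T := T)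
    (F := F.eval (pp.length + T) + 1) (K := c5.time) (h := proverCode N m)
    (Inv := Represents fr) (by omega)
    (fun c c' s he hr h => h.of_frame he fun r hk => hr r (by unfold Kept at hk; omega))
    (fun c' s' args res _ hI htot => by
      have := hF σ O fr c' s' args res hI
      rw [hpp] at this
      refine this.mono ?_
      rintro c'' a ⟨g1, g2, g3, g4⟩
      refine ⟨g1, g2, g3, g4.trans ?_⟩
      have := poly_eval_mono F (Nat.add_le_add_left htot pp.length)
      simp only at this
      omega)
    hcode (c := c5) (d := Cfg.start [unary n, pp, st, msg] s) fun _ =>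
      ⟨hmatch, rep5, by simp [Cfg.start]⟩
  refine Coupled.bind_left (R := fun c' d => c'.regs 2 = d.regs 0 ∧ c'.regs 10 = d.regs 1 ∧
    Represents fr c' d.env ∧ c'.time ≤ c5.time + (F.eval (pp.length + T) + 1) * T) ?_ ?_
  · refine sim.mono_support ?_
    rintro c' d h - hd
    have hdT := hT _ _ _ d hd
    obtain ⟨h1, h2, h3⟩ := h hdT
    exact ⟨h1 0 (by omega), h1 1 (by omega), h2,
      h3.trans (Nat.add_le_add_left (Nat.mul_le_mul_left _ hdT) _)⟩
  · rintro c' d ⟨h1, h2, h3, h4⟩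
    refine Reaches.coupled ((reaches_move _ _ (by omega)).seq ?_)
    rintro c6 ⟨g1, -, g3, g4, g5⟩
    refine (reaches_move _ _ (by omega)).mono ?_
    rintro c7 ⟨k1, -, k3, k4, k5⟩
    refine ⟨?_, ?_, h3.of_frame (k4.trans g4) fun r hr => ?_, ?_⟩
    · rw [k3 _ (by omega) (by omega), g1, h1]
    · rw [k1, g3 _ (by omega) (by omega), h2]
    · unfold Kept at hr
      rw [k3 _ (by omega) (by omega), g3 _ (by omega) (by omega)]
    · rw [x1] at t2; rw [x2] at t3
      simp only [unary, List.length_replicate] at t2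
      omega

/-- The oracle that the adversary faces, for a prover `P` with a state. -/
def Simulator.statefulOracle (D : Simulator) (P : Oracle τ) (n : ℕ) (pp : Word) :
    Oracle (Word × τ) := fun args s =>
  ((if args.getD 0 [] = [true] then D.issue else D.request).run P
    (Cfg.start [unary n, pp, s.1, args.getD 1 []] s.2)).map fun c => (c.regs 0, (c.regs 1, c.env))

/-- All programs of the simulator respect the bound `m` on registers. -/
def Simulator.RegsLt (D : Simulator) (m : ℕ) : Prop :=
  D.keyGen.RegsLt m ∧ D.request.RegsLt m ∧ D.issue.RegsLt m ∧ D.showPhase.RegsLt m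

/-- The programs of the simulator run in time `T` for the given parameters. -/
def Simulator.TimeBound (D : Simulator) (n : ℕ) (pp : Word) (T : ℕ) : Prop :=
  D.keyGen.TimeBound [unary n, pp] T ∧ ∀ st msg : Word,
    D.request.TimeBound [unary n, pp, st, msg] T ∧ D.issue.TimeBound [unary n, pp, st, msg] T ∧
    D.showPhase.TimeBound [unary n, pp, st, msg] T

/-- The code for a query of the adversary. -/
def queryCode (N : NIZK) (D : Simulator) (m : ℕ) (args : List ℕ) (res : ℕ) : Prog :=
  .seq (copyArg 1 args 1 rMsg) <| .seq (copyArg 1 args 0 rX) <|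
  .seq (.ifTop rX (some true)
      (.seq (.pop rX) (.ifTop rX none (activationCode N m D.issue) (activationCode N m D.request)))
      (activationCode N m D.request))
    (.move (8 * res + 1) rRes)

/-- The registers represent the states of the simulator and its prover. -/
def RepresentsSim (n : ℕ) (pp : Word) (c : Cfg σ) (s : Word × (ℕ × Bool × σ)) : Prop :=
  Represents c.regs c s.2 ∧ c.regs rN = unary n ∧ c.regs rPP = pp ∧ c.regs rSt = s.1

/-- The adversary's block is not mentioned, so its own instructions preserve this invariant. -/
theorem RepresentsSim.of_frame {n : ℕ} {pp : Word} {c c' : Cfg σ} {s : Word × (ℕ × Bool × σ)}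
    (h : RepresentsSim n pp c s) (he : c'.env = c.env)
    (hr : ∀ r, (r = rN ∨ r = rPP ∨ r = rSt ∨ r = rIdx ∨ r = rFlag) → c'.regs r = c.regs r) :
    RepresentsSim n pp c' s := by
  obtain ⟨h1, h2, h3, h4⟩ := h
  refine ⟨⟨he.trans h1.env, ?_, ?_, fun _ _ => rfl⟩, ?_, ?_, ?_⟩
  · rw [hr _ (by omega), h1.idx]
  · rw [hr _ (by omega), h1.flag]
  · rw [hr _ (by omega), h2]
  · rw [hr _ (by omega), h3]
  · rw [hr _ (by omega), h4]

/-- The cost of an activation. -/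
def activationCost (m : ℕ) (F : Polynomial ℕ) (n : ℕ) (pp : Word) (T : ℕ) : ℕ :=
  m + 10 + n + pp.length + (F.eval (pp.length + T) + 1) * T

/-- The adversary's registers survive because block `1` is among the kept registers of an
activation. Hence only the result register changes. -/
theorem queryCode_coupled {N : NIZK} {D : Simulator} {m T n : ℕ} {F : Polynomial ℕ}
    (hF : ProverCost N m F) (hm : 2 ≤ m) (hD : D.RegsLt m) {O : Oracle σ} {pp : Word}
    (hT : D.TimeBound n pp T) {c : Cfg σ} {s : Word × (ℕ × Bool × σ)} {args : List ℕ} {res : ℕ}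
    (hc : RepresentsSim n pp c s) :
    Coupled (fun c' a => c'.regs (8 * res + 1) = a.1 ∧
        (∀ r, r ≠ res → c'.regs (8 * r + 1) = c.regs (8 * r + 1)) ∧ RepresentsSim n pp c' a.2 ∧
        c'.time ≤ c.time + (6 + 2 * totalLength (args.map fun r => c.regs (8 * r + 1)) +
          activationCost m F n pp T))
      ((queryCode N D m args res).run O c)
      (D.statefulOracle (N.gameProver O pp) n pp (args.map fun r => c.regs (8 * r + 1)) s) := by
  set ws := args.map fun r => c.regs (8 * r + 1) with hws
  obtain ⟨h1, h2, h3, h4⟩ := hc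
  obtain ⟨-, hT⟩ := hT
  obtain ⟨-, hreq, hiss, -⟩ := hD
  unfold queryCode
  refine (reaches_copyArg 1 args 1 rMsg (by omega)).seq_coupled ?_
  rintro c1 ⟨x1, f1, e1, t1⟩
  rw [← hws] at x1 t1
  refine (reaches_copyArg 1 args 0 rX (by omega)).seq_coupled ?_
  rintro c2 ⟨x2, f2, e2, t2⟩
  have hws1 : (args.map fun r => c1.regs (8 * r + 1)) = ws :=
    List.map_congr_left fun r _ => f1 _ (by omega) (by omega)
  rw [hws1] at x2 t2
  have frame2 : ∀ r, r ≠ 8 → r ≠ rX → r ≠ rMsg → c2.regs r = c.regs r := fun r h1 h2 h3 => by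
    rw [f2 r h2 h1, f1 r h3 h1]
  have x3 : c2.regs rMsg = ws.getD 1 [] := by rw [f2 _ (by omega) (by omega), x1]
  have act : ∀ (code : Prog), code.RegsLt m →
      code.TimeBound [unary n, pp, s.1, ws.getD 1 []] T → ∀ c3 : Cfg σ,
      (∀ r, r ≠ rX → c3.regs r = c2.regs r) → c3.env = c2.env → c3.time ≤ c2.time + 3 →
      Coupled (fun c' a => c'.regs rRes = a.1 ∧
        (∀ r, c'.regs (8 * r + 1) = c.regs (8 * r + 1)) ∧ RepresentsSim n pp c' a.2 ∧
        c'.time ≤ c.time + (5 + 2 * totalLength ws + activationCost m F n pp T))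
      ((activationCode N m code).run O c3)
      ((code.run (N.gameProver O pp) (Cfg.start [unary n, pp, s.1, ws.getD 1 []] s.2)).map
        fun c => (c.regs 0, (c.regs 1, c.env))) := by
    intro code hcode hTc c3 f3 e3 t3
    have rep3 : Represents c.regs c3 s.2 := h1.of_frame (by rw [e3, e2, e1]) fun r hr => by
      unfold Kept at hr
      rw [f3 _ (by omega), frame2 _ (by omega) (by omega) (by omega)]
    refine (activationCode_coupled hF hm hcode rep3 h2 h3 ?_ ?_ hTc).map_right ?_
    · rw [f3 _ (by omega), frame2 _ (by omega) (by omega) (by omega), h4]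
    · rw [f3 _ (by omega), x3]
    · rintro c' d ⟨g1, g2, g3, g4⟩
      refine ⟨g1, fun r => g3.kept _ (.inl (by omega)), ⟨⟨g3.env, g3.idx, g3.flag, fun _ _ => rfl⟩,
        (g3.kept _ (.inr (.inl rfl))).trans h2,
        (g3.kept _ (.inr (.inr (.inl rfl)))).trans h3, g2⟩, ?_⟩
      unfold activationCost
      omega
  refine Coupled.bind_left (R := fun c' a => c'.regs rRes = a.1 ∧
    (∀ r, c'.regs (8 * r + 1) = c.regs (8 * r + 1)) ∧ RepresentsSim n pp c' a.2 ∧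
    c'.time ≤ c.time + (5 + 2 * totalLength ws + activationCost m F n pp T)) ?_ ?_
  · unfold Simulator.statefulOracle
    -- The selector has to equal the one-bit string `1`: its first bit is tested, then removed, and
    -- the rest must be empty.
    by_cases hsel : ws.getD 0 [] = [true]
    · rw [if_pos hsel]
      have q1 : (c2.regs rX).head? = some true := by rw [x2, hsel]; rfl
      have q2 : ((((c2.tick 1).set rX ((c2.tick 1).regs rX).tail).tick 1).regs rX).head? = none := by
        simp only [Cfg.tick_regs, Cfg.set_regs, Function.update_self, x2, hsel]; rfl
      simp only [Prog.run, if_pos q1, PMF.pure_bind]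
      rw [if_pos q2]
      refine act _ hiss (hT _ _).2.1 _ (fun r hr => ?_) rfl ?_
      · simp [Function.update_of_ne hr]
      · simp only [Cfg.tick_time, Cfg.set_time]; omega
    · rw [if_neg hsel]
      by_cases q1 : (c2.regs rX).head? = some true
      · have q2 : ((((c2.tick 1).set rX ((c2.tick 1).regs rX).tail).tick 1).regs rX).head? ≠ none := by
          rw [x2] at q1
          intro h
          apply hsel
          rw [Cfg.tick_regs, Cfg.set_regs, Cfg.tick_regs, x2] at h
          simp only [Function.update_self, List.head?_eq_none_iff] at h
          cases hw : ws.getD 0 [] with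
          | nil => rw [hw] at q1; simp at q1
          | cons a l => rw [hw] at q1 h; simp at q1 h; rw [q1, h]
        simp only [Prog.run, if_pos q1, PMF.pure_bind]
        rw [if_neg q2]
        refine act _ hreq (hT _ _).1 _ (fun r hr => ?_) rfl ?_
        · simp [Function.update_of_ne hr]
        · simp only [Cfg.tick_time, Cfg.set_time]; omega
      · simp only [Prog.run, if_neg q1]
        refine act _ hreq (hT _ _).1 _ (fun r hr => rfl) rfl ?_
        simp only [Cfg.tick_time]; omega
  · rintro c' a ⟨g1, g2, g3, g4⟩
    refine Reaches.coupled ((reaches_move _ _ (by omega)).mono ?_)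
    rintro c'' ⟨k1, -, k3, k4, k5⟩
    refine ⟨k1.trans g1, fun r hr => ?_, g3.of_frame k4 fun r hr => ?_, by omega⟩
    · rw [k3 _ (by omega) (by omega), g2]
    · exact k3 _ (by omega) (by omega)

end

/-! ### Arithmetic in unary -/

section

variable {σ : Type} {O : Oracle σ} {c : Cfg σ}

/-- Push `b ^ k` bits on `dst`, where `b` is the length of the register `base`. -/
def pushPow (base dst : ℕ) : ℕ → Prog
  | 0 => .push dst true
  | k + 1 => .loop base (pushPow base dst k)

/-- The running time of `pushPow`. -/
def pushPowCost (b : ℕ) : ℕ → ℕ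
  | 0 => 1
  | k + 1 => 1 + b + b * pushPowCost b k

theorem reaches_pushPow {base dst : ℕ} (h : base ≠ dst) (k : ℕ) :
    Reaches O (pushPow base dst k) c fun c' =>
      c'.regs dst = List.replicate ((c.regs base).length ^ k) true ++ c.regs dst ∧
      (∀ r, r ≠ dst → c'.regs r = c.regs r) ∧ c'.env = c.env ∧
      c'.time = c.time + pushPowCost (c.regs base).length k := by
  induction k generalizing c with
  | zero => exact (reaches_push _ _).mono fun c' h => by simpa [pushPowCost] using h
  | succ k ih =>
    refine (reaches_loop (I := fun i c' =>
      c'.regs dst = List.replicate (i * (c.regs base).length ^ k) true ++ c.regs dst ∧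
      (∀ r, r ≠ dst → c'.regs r = c.regs r) ∧ c'.env = c.env ∧
      c'.time = c.time + 1 + (c.regs base).length + i * pushPowCost (c.regs base).length k)
      ?_ ?_).mono ?_
    · exact ⟨by simp, fun _ _ => rfl, rfl, by simp [Nat.add_assoc]⟩
    · rintro i c1 - ⟨h1, h2, h3, h4⟩
      refine ih.mono ?_
      rintro c2 ⟨g1, g2, g3, g4⟩
      rw [h2 base h] at g1 g4
      refine ⟨?_, fun r hr => (g2 r hr).trans (h2 r hr), g3.trans h3, ?_⟩
      · rw [g1, h1, ← List.append_assoc, ← List.replicate_add, Nat.succ_mul, Nat.add_comm]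
      · rw [g4, h4, Nat.succ_mul]; omega
    · rintro c' ⟨h1, h2, h3, h4⟩
      refine ⟨by rw [h1, pow_succ, Nat.mul_comm], h2, h3, ?_⟩
      rw [h4, pushPowCost]; omega

/-- Double the length of a register. -/
def doubleCode (r : ℕ) : Prog := .loop r (.push r true)

theorem reaches_doubleCode (r : ℕ) : Reaches O (doubleCode r) c fun c' =>
    (c'.regs r).length = 2 * (c.regs r).length ∧ (∀ s, s ≠ r → c'.regs s = c.regs s) ∧
    c'.env = c.env ∧ c'.time = c.time + 1 + 2 * (c.regs r).length := by
  refine (reaches_loop (I := fun i c' => (c'.regs r).length = i + (c.regs r).length ∧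
    (∀ s, s ≠ r → c'.regs s = c.regs s) ∧ c'.env = c.env ∧
    c'.time = c.time + 1 + (c.regs r).length + i) ?_ ?_).mono ?_
  · exact ⟨by simp, fun _ _ => rfl, rfl, by simp [Nat.add_assoc]⟩
  · rintro i c1 - ⟨h1, h2, h3, h4⟩
    refine (reaches_push _ _).mono ?_
    rintro c2 ⟨g1, g2, g3, g4⟩
    refine ⟨?_, fun s hs => (g2 s hs).trans (h2 s hs), g3.trans h3, by omega⟩
    rw [g1, List.length_cons]; omega
  · rintro c' ⟨h1, h2, h3, h4⟩
    exact ⟨by omega, h2, h3, by omega⟩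

/-- Halve the length of register `r`, with the help of register `par`. -/
def halveCode (r par : ℕ) : Prog :=
  .seq (.move 8 par) (.loop r (.ifTop par none (.seq (.pop r) (.push par true)) (.pop par)))

/-- The register `par` holds the parity of the round and a bit is removed in every second round,
starting with the first. The number of rounds is fixed on entry, so shrinking `r` inside the loop is
harmless. -/
theorem reaches_halveCode {r par : ℕ} (h : r ≠ par) (hr : r ≠ 8) (hpar : par ≠ 8) :
    Reaches O (halveCode r par) c fun c' =>
      (c'.regs r).length = (c.regs r).length / 2 ∧
      (∀ s, s ≠ r → s ≠ par → s ≠ 8 → c'.regs s = c.regs s) ∧ c'.env = c.env ∧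
      c'.time ≤ c.time + 2 + 4 * (c.regs r).length := by
  unfold halveCode
  refine (reaches_move _ _ hpar.symm).seq ?_
  rintro c0 ⟨-, e0, f0, v0, t0⟩
  have hl : c0.regs r = c.regs r := f0 r hr h
  refine (reaches_loop (I := fun i c' => (c'.regs r).length = (c.regs r).length - (i + 1) / 2 ∧
    (c'.regs par).length = i % 2 ∧ (∀ s, s ≠ r → s ≠ par → s ≠ 8 → c'.regs s = c.regs s) ∧
    c'.env = c.env ∧ c'.time ≤ c.time + 2 + (c.regs r).length + 3 * i) ?_ ?_).mono ?_
  · refine ⟨by simp [hl], by simp [e0], fun s _ h2 h3 => f0 s h3 h2, v0, ?_⟩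
    rw [hl, Cfg.tick_time]; omega
  · rintro i c1 hi ⟨h1, h2, h3, h4, h5⟩
    by_cases hp : (c1.regs par).head? = none
    · have hp' := hp
      rw [List.head?_eq_none_iff, ← List.length_eq_zero_iff] at hp'
      refine .ifTop_pos hp ((reaches_pop _).seq ?_)
      rintro c2 ⟨x2, f2, e2, t2⟩
      refine (reaches_push _ _).mono ?_
      rintro c3 ⟨x3, f3, e3, t3⟩
      simp only [Cfg.tick_regs, Cfg.tick_env, Cfg.tick_time] at x2 f2 e2 t2
      refine ⟨?_, ?_, fun s a1 a2 a3 => ?_, by rw [e3, e2, h4], by omega⟩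
      · rw [f3 _ h, x2, List.length_tail]; omega
      · rw [x3, f2 _ h.symm, List.length_cons]; omega
      · rw [f3 s a2, f2 s a1, h3 s a1 a2 a3]
    · have hp' := hp
      rw [List.head?_eq_none_iff, ← List.length_eq_zero_iff] at hp'
      refine .ifTop_neg hp ((reaches_pop _).mono ?_)
      rintro c2 ⟨x2, f2, e2, t2⟩
      simp only [Cfg.tick_regs, Cfg.tick_env, Cfg.tick_time] at x2 f2 e2 t2
      refine ⟨?_, ?_, fun s a1 a2 a3 => ?_, by rw [e2, h4], by omega⟩
      · rw [f2 _ h]; omega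
      · rw [x2, List.length_tail]; omega
      · rw [f2 s a2, h3 s a1 a2 a3]
  · rintro c' ⟨h1, -, h3, h4, h5⟩
    rw [hl] at h1 h5
    exact ⟨by omega, h3, h4, by omega⟩

/-- Move one bit from `src` to `dst`. -/
def moveBit (src dst : ℕ) : Prog :=
  .ifTop src none .skip
    (.seq (.ifTop src (some true) (.push dst true) (.push dst false)) (.pop src))

theorem reaches_moveBit {src dst : ℕ} (h : src ≠ dst) : Reaches O (moveBit src dst) c fun c' =>
    c'.regs dst = ((c.regs src).take 1).reverse ++ c.regs dst ∧
    c'.regs src = (c.regs src).drop 1 ∧ (∀ s, s ≠ src → s ≠ dst → c'.regs s = c.regs s) ∧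
    c'.env = c.env ∧ c'.time ≤ c.time + 4 := by
  unfold moveBit
  cases hs : c.regs src with
  | nil =>
    refine .ifTop_pos (by simp [hs]) ⟨_, rfl, by simp, by simp [hs], fun _ _ _ => rfl, rfl, ?_⟩
    simp only [Cfg.tick_time]; omega
  | cons b l =>
    refine .ifTop_neg (by simp [hs]) (Reaches.seq
      (P := fun c' => c'.regs dst = b :: c.regs dst ∧ (∀ s, s ≠ dst → c'.regs s = c.regs s) ∧
        c'.env = c.env ∧ c'.time ≤ c.time + 3) ?_ ?_)
    · cases b with
      | false => exact .ifTop_neg (by simp [hs]) ((reaches_push _ _).mono fun _ h => h.imp_right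
          fun h => h.imp_right fun h => h.imp_right fun h => by simp at h; omega)
      | true => exact .ifTop_pos (by simp [hs]) ((reaches_push _ _).mono fun _ h => h.imp_right
          fun h => h.imp_right fun h => h.imp_right fun h => by simp at h; omega)
    · rintro c1 ⟨x1, f1, e1, t1⟩
      refine (reaches_pop _).mono ?_
      rintro c2 ⟨x2, f2, e2, t2⟩
      refine ⟨?_, ?_, fun s a1 a2 => ?_, e2.trans e1, by omega⟩
      · rw [f2 _ h.symm, x1]; simp
      · rw [x2, f1 _ h, hs]; simp
      · rw [f2 s a1, f1 s a2]

theorem reaches_loop_moveBit {cnt src dst : ℕ} (h : src ≠ dst) :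
    Reaches O (.loop cnt (moveBit src dst)) c fun c' =>
      c'.regs dst = ((c.regs src).take (c.regs cnt).length).reverse ++ c.regs dst ∧
      (∀ s, s ≠ src → s ≠ dst → c'.regs s = c.regs s) ∧
      c'.env = c.env ∧ c'.time ≤ c.time + 1 + 5 * (c.regs cnt).length := by
  refine (reaches_loop (I := fun i c' =>
    c'.regs dst = ((c.regs src).take i).reverse ++ c.regs dst ∧
    c'.regs src = (c.regs src).drop i ∧
    (∀ s, s ≠ src → s ≠ dst → c'.regs s = c.regs s) ∧
    c'.env = c.env ∧ c'.time ≤ c.time + 1 + (c.regs cnt).length + 4 * i) ?_ ?_).mono ?_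
  · exact ⟨by simp, by simp, fun _ _ _ => rfl, rfl, by simp [Nat.add_assoc]⟩
  · rintro i c1 - ⟨h1, h2, h3, h4, h5⟩
    refine (reaches_moveBit h).mono ?_
    rintro c2 ⟨g1, g2, g3, g4, g5⟩
    refine ⟨?_, ?_, fun s a b => (g3 s a b).trans (h3 s a b), g4.trans h4, by omega⟩
    · rw [g1, h1, h2, List.take_add, List.reverse_append, List.append_assoc]
    · rw [g2, h2, List.drop_drop]
  · rintro c' ⟨h1, -, h3, h4, h5⟩
    exact ⟨h1, h3, h4, by omega⟩

/-- Truncate the answer in `rRes` to the length of `rLen` and store the result in `rPk`. -/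
def truncateCode : Prog :=
  .seq (.move 8 rTmp) <| .seq (.move 8 rPk) <| .seq (.loop rLen (moveBit rRes rTmp))
    (.loop rTmp (moveBit rTmp rPk))

/-- Bit by bit transfer reverses a string; the detour through `rTmp` reverses it twice. The cost
depends on the length of `rLen` only, not on that of the answer. -/
theorem reaches_truncateCode : Reaches O truncateCode c fun c' =>
    c'.regs rPk = (c.regs rRes).take (c.regs rLen).length ∧
    (∀ s, s ≠ 8 → s ≠ rTmp → s ≠ rPk → s ≠ rRes → c'.regs s = c.regs s) ∧
    c'.env = c.env ∧ c'.time ≤ c.time + 4 + 10 * (c.regs rLen).length := by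
  unfold truncateCode
  refine (reaches_move _ _ (by omega)).seq ?_
  rintro c1 ⟨-, x1, f1, e1, t1⟩
  refine (reaches_move _ _ (by omega)).seq ?_
  rintro c2 ⟨-, x2, f2, e2, t2⟩
  refine (reaches_loop_moveBit (by omega)).seq ?_
  rintro c3 ⟨x3, f3, e3, t3⟩
  refine (reaches_loop_moveBit (by omega)).mono ?_
  rintro c4 ⟨x4, f4, e4, t4⟩
  have y1 : c2.regs rTmp = [] := by rw [f2 _ (by omega) (by omega), x1]
  have y2 : c2.regs rRes = c.regs rRes := by
    rw [f2 _ (by omega) (by omega), f1 _ (by omega) (by omega)]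
  have y3 : c2.regs rLen = c.regs rLen := by
    rw [f2 _ (by omega) (by omega), f1 _ (by omega) (by omega)]
  have y4 : c3.regs rPk = [] := by rw [f3 _ (by omega) (by omega), x2]
  rw [y1, y2, y3, List.append_nil] at x3
  rw [y3] at t3
  rw [x3] at x4 t4
  refine ⟨?_, fun s a b d e => ?_, by rw [e4, e3, e2, e1], ?_⟩
  · rw [x4, y4, List.append_nil, List.take_length, List.reverse_reverse]
  · rw [f4 s b d, f3 s e b, f2 s a d, f1 s a b]
  · simp only [List.length_reverse, List.length_take] at t4
    omega

/-! ### Sampling the index of the challenge -/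

/-- The uniform distribution on the numbers below `2 ^ k`. -/
def uniformBelow : ℕ → PMF ℕ
  | 0 => PMF.pure 0
  | k + 1 => (uniformBelow k).bind fun i =>
      (PMF.uniformOfFintype Bool).map fun b => 2 * i + b.toNat

/-- A round of the sampling: unless `rHalf` is exhausted, halve it and append a random bit to the
binary expansion of the length of `rIdx`. -/
def sampleRound : Prog :=
  .ifTop rHalf none .skip <| .seq (halveCode rHalf rPar) <| .seq (doubleCode rIdx) <|
    .seq (.coin rCoin) (.ifTop rCoin (some true) (.push rIdx true) .skip)

theorem sampleRound_coupled {h : ℕ} (hh : (c.regs rHalf).length = h) (hpos : 0 < h) :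
    Coupled (fun c' b => (c'.regs rHalf).length = h / 2 ∧
        (c'.regs rIdx).length = 2 * (c.regs rIdx).length + b.toNat ∧
        (∀ r, r ≠ 8 → r ≠ rHalf → r ≠ rPar → r ≠ rIdx → r ≠ rCoin → c'.regs r = c.regs r) ∧
        c'.env = c.env ∧ c'.time ≤ c.time + (7 + 4 * h + 2 * (c.regs rIdx).length))
      (sampleRound.run O c) (PMF.uniformOfFintype Bool) := by
  have h1 : (c.regs rHalf).head? ≠ none := by
    intro h0
    rw [List.head?_eq_none_iff, ← List.length_eq_zero_iff] at h0
    omega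
  unfold sampleRound
  rw [Prog.run, if_neg h1]
  refine (reaches_halveCode (by omega) (by omega) (by omega)).seq_coupled ?_
  rintro c1 ⟨x1, f1, e1, t1⟩
  refine (reaches_doubleCode _).seq_coupled ?_
  rintro c2 ⟨x2, f2, e2, t2⟩
  simp only [Cfg.tick_regs, Cfg.tick_env, Cfg.tick_time, hh] at x1 f1 e1 t1
  have y1 : c1.regs rIdx = c.regs rIdx := f1 _ (by omega) (by omega) (by omega)
  rw [y1] at x2 t2
  simp only [Prog.run, PMF.bind_bind, PMF.pure_bind]
  refine (Coupled.refl _).bind_left ?_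
  rintro b _ rfl
  have y2 : (c2.regs rHalf).length = h / 2 := by rw [f2 _ (by omega), x1]
  cases b with
  | false =>
    simp only [Cfg.tick_regs, Cfg.set_regs, Function.update_self, List.head?_cons]
    refine .pure ⟨?_, ?_, ?_, ?_, ?_⟩
    · simpa using y2
    · simpa using x2
    · intro r a1 a2 a3 a4 a5
      simp only [Cfg.tick_regs, Cfg.set_regs, Function.update_of_ne a5]
      rw [f2 r a4, f1 r a2 a3 a1]
    · simp [e2, e1]
    · simp only [Cfg.tick_time, Cfg.set_time]; omega
  | true =>
    simp only [Cfg.tick_regs, Cfg.set_regs, Function.update_self, List.head?_cons, if_true]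
    refine .pure ⟨?_, ?_, ?_, ?_, ?_⟩
    · simpa using y2
    · simpa using x2
    · intro r a1 a2 a3 a4 a5
      simp only [Cfg.tick_regs, Cfg.set_regs, Function.update_of_ne a5, Function.update_of_ne a4]
      rw [f2 r a4, f1 r a2 a3 a1]
    · simp [e2, e1]
    · simp only [Cfg.tick_time, Cfg.set_time]; omega

/-- Sample a number below `2 ^ k` uniformly, where `k` is the number of binary digits of the
length of register `rNum`. -/
def sampleCode : Prog :=
  .seq (.move 8 rIdx) <| .seq (.copy rHalf rNum) (.loop rNum sampleRound)

theorem sampleCode_coupled {M : ℕ} (hM : (c.regs rNum).length = M) :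
    Coupled (fun c' i => (c'.regs rIdx).length = i ∧
        (∀ r, r ≠ 8 → r ≠ rHalf → r ≠ rPar → r ≠ rIdx → r ≠ rCoin → c'.regs r = c.regs r) ∧
        c'.env = c.env ∧ c'.time ≤ c.time + (3 + 2 * M + M * (7 + 6 * M)))
      (sampleCode.run O c) (uniformBelow M.size) := by
  unfold sampleCode
  refine (reaches_move _ _ (by omega)).seq_coupled ?_
  rintro c1 ⟨-, x1, f1, e1, t1⟩
  refine (reaches_copy _ _).seq_coupled ?_
  rintro c2 ⟨x2, f2, e2, t2⟩
  have y1 : c1.regs rNum = c.regs rNum := f1 _ (by omega) (by omega)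
  have y2 : (c2.regs rNum).length = M := by rw [f2 _ (by omega), y1, hM]
  have y3 : c2.regs rIdx = [] := by rw [f2 _ (by omega), x1]
  rw [y1, hM] at t2
  have frame2 : ∀ r, r ≠ 8 → r ≠ rHalf → r ≠ rPar → r ≠ rIdx → r ≠ rCoin →
      c2.regs r = c.regs r := fun r a1 a2 a3 a4 a5 => by rw [f2 r a2, f1 r a1 a4]
  have hsize : M.size ≤ M := Nat.size_le.2 Nat.lt_two_pow_self
  simp only [Prog.run, y2]
  -- The length of `rHalf` remains positive before each of the first `M.size` rounds, so these
  -- append a bit each. The bound `i < 2 ^ k` is kept to control the cost of doubling.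
  have key : ∀ k ≤ M.size, Coupled (fun c' i => (c'.regs rHalf).length = M / 2 ^ k ∧
      (c'.regs rIdx).length = i ∧ i < 2 ^ k ∧
      (∀ r, r ≠ 8 → r ≠ rHalf → r ≠ rPar → r ≠ rIdx → r ≠ rCoin → c'.regs r = c.regs r) ∧
      c'.env = c.env ∧ c'.time ≤ c.time + (3 + 2 * M + k * (7 + 6 * M)))
      (repeatM (sampleRound.run O) k (c2.tick (1 + M))) (uniformBelow k) := by
    intro k hk
    induction k with
    | zero =>
      refine .pure ⟨by simp [x2, y1, hM], by simp [y3], by simp, frame2, by simp [e2, e1], ?_⟩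
      simp only [Cfg.tick_time]; omega
    | succ k ih =>
      rw [repeatM_succ_right]
      refine (ih (by omega)).bind ?_
      rintro c' i ⟨h1, h2, h3, h4, h5, h6⟩
      have hk2 : 2 ^ k ≤ M := Nat.lt_size.1 hk
      have hpos : 0 < M / 2 ^ k := Nat.div_pos hk2 (by positivity)
      refine (sampleRound_coupled h1 hpos).map_right ?_
      rintro c'' b ⟨g1, g2, g3, g4, g5⟩
      have hle : M / 2 ^ k ≤ M := Nat.div_le_self _ _
      refine ⟨?_, by rw [g2, h2], ?_, fun r a1 a2 a3 a4 a5 => ?_, g4.trans h5, ?_⟩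
      · rw [g1, Nat.div_div_eq_div_mul, pow_succ]
      · have := Bool.toNat_le b
        rw [pow_succ]; omega
      · rw [g3 r a1 a2 a3 a4 a5, h4 r a1 a2 a3 a4 a5]
      · rw [h2] at g5
        have : (k + 1) * (7 + 6 * M) = k * (7 + 6 * M) + (7 + 6 * M) := by ring
        omega
  -- The loop makes `M` rounds. After the first `M.size` of them `rHalf` is empty, and the remaining
  -- rounds idle for two steps each.
  have hsplit : M = M.size + (M - M.size) := by omega
  conv => enter [2]; rw [hsplit]
  rw [repeatM_add, ← hsplit]
  refine Coupled.bind_left (key _ le_rfl) ?_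
  rintro c3 i ⟨h1, h2, h3, h4, h5, h6⟩
  rw [Nat.div_eq_of_lt (Nat.lt_size_self M)] at h1
  have hrun : ∀ j, ∃ t ≤ 2 * j, repeatM (sampleRound.run O) j c3 = PMF.pure (c3.tick t) := by
    intro j
    induction j with
    | zero => exact ⟨0, by omega, rfl⟩
    | succ j ih =>
      obtain ⟨t, ht, hj⟩ := ih
      refine ⟨t + 2, by omega, ?_⟩
      have h7 : ((c3.tick t).regs rHalf).head? = none := by
        rw [List.head?_eq_none_iff, ← List.length_eq_zero_iff]; exact h1
      rw [repeatM_succ_right, hj, PMF.pure_bind]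
      simp only [sampleRound, Prog.run, if_pos h7]
      rfl
  obtain ⟨t, ht, hj⟩ := hrun (M - M.size)
  rw [hj]
  refine .pure ⟨h2, h4, h5, ?_⟩
  have : M * (7 + 6 * M) = M.size * (7 + 6 * M) + (M - M.size) * (7 + 6 * M) := by
    rw [← Nat.add_mul, ← hsplit]
  have h8 : (M - M.size) * 2 ≤ (M - M.size) * (7 + 6 * M) := Nat.mul_le_mul_left _ (by omega)
  simp only [Cfg.tick_time]
  omega

end

/-! ### The reduction -/

/-- The privacy experiment for given parameters, with a prover that has a state, and with the
public keys truncated to length `L`. -/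
def simExperiment {τ : Type} (P : Oracle τ) (t : τ) (D : Simulator) (B : Prog) (n : ℕ) (pp : Word)
    (L : ℕ) : PMF Bool :=
  (D.keyGen.run P (Cfg.start [unary n, pp] t)).bind fun k =>
    (B.run (D.statefulOracle P n pp)
        (Cfg.start [unary n, pp, (k.regs 0).take L] (k.regs 1, k.env))).bind fun c =>
      (D.showPhase.run P (Cfg.start [unary n, pp, c.env.1, c.regs 0] c.env.2)).map fun v =>
        decide (v.regs 0 = [true])

/-- Set up the registers: the inputs are a string of length `n` and the parameters; the lengths of
`rLen` and `rNum` become `(n + 2) ^ a` and `(n + 2) ^ b`. -/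
def initCode (a b : ℕ) : Prog :=
  .seq (.move rPP 1) <| .seq (.move 8 rN) <| .seq (pushPow 0 rN 1) <| .seq (.copy rBase rN) <|
  .seq (.push rBase true) <| .seq (.push rBase true) <|
  .seq (.move 8 rLen) <| .seq (pushPow rBase rLen a) <|
  .seq (.move 8 rNum) <| .seq (pushPow rBase rNum b) <|
  .seq (.move 8 rFlag) <| .seq (.move 8 rSt) (.move 8 rMsg)

/-- Set up the block of the adversary. -/
def startCode (m : ℕ) : Prog :=
  .seq (clearBlock 1 m) <| .seq (.copy 1 rN) <| .seq (.copy 9 rPP) (.move 17 rPk)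

/-- The adversary against randomizability that simulates the privacy experiment, with its challenge
in the place of a random proof. -/
def reduction (N : NIZK) (D : Simulator) (B : Prog) (m a b : ℕ) : Prog :=
  .seq (initCode a b) <| .seq sampleCode <| .seq (activationCode N m D.keyGen) <|
  .seq truncateCode <| .seq (startCode m) <| .seq (B.inline 1 (queryCode N D m)) <|
  .seq (.move rMsg 1) <| .seq (activationCode N m D.showPhase) (.move 0 rRes)

section

variable {σ : Type} {O : Oracle σ} {c : Cfg σ}

/-- The running time is to be bounded on all inputs, not only on `1ⁿ` and parameters. The unary
string is therefore rebuilt from the length of register `0`, and registers that further inputs may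
have filled are emptied. -/
theorem reaches_initCode (a b : ℕ) {n : ℕ} (hn : (c.regs 0).length = n) :
    Reaches O (initCode a b) c fun c' => c'.regs rN = unary n ∧ c'.regs rPP = c.regs 1 ∧
      (c'.regs rLen).length = (n + 2) ^ a ∧ (c'.regs rNum).length = (n + 2) ^ b ∧
      c'.regs rFlag = [] ∧ c'.regs rSt = [] ∧ c'.regs rMsg = [] ∧ c'.env = c.env ∧
      c'.time = c.time + (10 + n + pushPowCost n 1 + pushPowCost (n + 2) a +
        pushPowCost (n + 2) b) := by
  unfold initCode
  refine (reaches_move _ _ (by omega)).seq ?_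
  rintro c1 ⟨x1, -, f1, e1, t1⟩
  refine (reaches_move _ _ (by omega)).seq ?_
  rintro c2 ⟨-, x2, f2, e2, t2⟩
  refine (reaches_pushPow (by omega) _).seq ?_
  rintro c3 ⟨x3, f3, e3, t3⟩
  refine (reaches_copy _ _).seq ?_
  rintro c4 ⟨x4, f4, e4, t4⟩
  refine (reaches_push _ _).seq ?_
  rintro c5 ⟨x5, f5, e5, t5⟩
  refine (reaches_push _ _).seq ?_
  rintro c6 ⟨x6, f6, e6, t6⟩
  refine (reaches_move _ _ (by omega)).seq ?_
  rintro c7 ⟨-, x7, f7, e7, t7⟩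
  refine (reaches_pushPow (by omega) _).seq ?_
  rintro c8 ⟨x8, f8, e8, t8⟩
  refine (reaches_move _ _ (by omega)).seq ?_
  rintro c9 ⟨-, x9, f9, e9, t9⟩
  refine (reaches_pushPow (by omega) _).seq ?_
  rintro c10 ⟨x10, f10, e10, t10⟩
  refine (reaches_move _ _ (by omega)).seq ?_
  rintro c11 ⟨-, x11, f11, e11, t11⟩
  refine (reaches_move _ _ (by omega)).seq ?_
  rintro c12 ⟨-, x12, f12, e12, t12⟩
  refine (reaches_move _ _ (by omega)).mono ?_
  rintro c13 ⟨-, x13, f13, e13, t13⟩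
  have y0 : (c2.regs 0).length = n := by
    rw [f2 _ (by omega) (by omega), f1 _ (by omega) (by omega), hn]
  rw [y0, pow_one, x2, List.append_nil] at x3
  rw [y0] at t3
  have y4 : (c4.regs rBase).length = n := by rw [x4, x3, List.length_replicate]
  have y6 : (c6.regs rBase).length = n + 2 := by
    rw [x6, x5, List.length_cons, List.length_cons, y4]
  have y7 : (c7.regs rBase).length = n + 2 := by rw [f7 _ (by omega) (by omega), y6]
  have y9 : (c9.regs rBase).length = n + 2 := by
    rw [f9 _ (by omega) (by omega), f8 _ (by omega), y7]
  rw [y7, x7, List.append_nil] at x8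
  rw [y7] at t8
  rw [y9, x9, List.append_nil] at x10
  rw [y9] at t10
  rw [x3, List.length_replicate] at t4
  refine ⟨?_, ?_, ?_, ?_, ?_, ?_, x13, ?_, by omega⟩
  · rw [f13 _ (by omega) (by omega), f12 _ (by omega) (by omega), f11 _ (by omega) (by omega),
      f10 _ (by omega), f9 _ (by omega) (by omega), f8 _ (by omega), f7 _ (by omega) (by omega),
      f6 _ (by omega), f5 _ (by omega), f4 _ (by omega), x3, unary]
  · rw [f13 _ (by omega) (by omega), f12 _ (by omega) (by omega), f11 _ (by omega) (by omega),
      f10 _ (by omega), f9 _ (by omega) (by omega), f8 _ (by omega), f7 _ (by omega) (by omega),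
      f6 _ (by omega), f5 _ (by omega), f4 _ (by omega), f3 _ (by omega),
      f2 _ (by omega) (by omega), x1]
  · rw [f13 _ (by omega) (by omega), f12 _ (by omega) (by omega), f11 _ (by omega) (by omega),
      f10 _ (by omega), f9 _ (by omega) (by omega), x8, List.length_replicate]
  · rw [f13 _ (by omega) (by omega), f12 _ (by omega) (by omega), f11 _ (by omega) (by omega),
      x10, List.length_replicate]
  · rw [f13 _ (by omega) (by omega), f12 _ (by omega) (by omega), x11]
  · rw [f13 _ (by omega) (by omega), x12]
  · rw [e13, e12, e11, e10, e9, e8, e7, e6, e5, e4, e3, e2, e1]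

theorem reaches_startCode (m : ℕ) :
    Reaches O (startCode m) c fun c' =>
      (∀ r < m, c'.regs (8 * r + 1) = Regs.ofInputs [c.regs rN, c.regs rPP, c.regs rPk] r) ∧
      (∀ r, r % 8 ≠ 1 → r ≠ 8 → r ≠ rPk → c'.regs r = c.regs r) ∧ c'.env = c.env ∧
      c'.time = c.time + (m + 4 + (c.regs rN).length + (c.regs rPP).length) := by
  unfold startCode
  refine (reaches_clearBlock (by omega) m).seq ?_
  rintro c1 ⟨z1, f1, e1, t1⟩
  refine (reaches_copy _ _).seq ?_
  rintro c2 ⟨z2, f2, e2, t2⟩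
  refine (reaches_copy _ _).seq ?_
  rintro c3 ⟨z3, f3, e3, t3⟩
  refine (reaches_move _ _ (by omega)).mono ?_
  rintro c4 ⟨z4, -, f4, e4, t4⟩
  have x1 : c1.regs rN = c.regs rN := f1 _ (by omega) (by omega)
  have x2 : c2.regs rPP = c.regs rPP := by rw [f2 _ (by omega), f1 _ (by omega) (by omega)]
  have x3 : c3.regs rPk = c.regs rPk := by
    rw [f3 _ (by omega), f2 _ (by omega), f1 _ (by omega) (by omega)]
  refine ⟨?_, fun r hr h8 hk => ?_, by rw [e4, e3, e2, e1], ?_⟩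
  · intro r hr
    match r, hr with
    | 0, _ =>
      rw [f4 _ (by omega) (by omega), f3 _ (by omega)]
      exact z2.trans x1
    | 1, _ =>
      rw [f4 _ (by omega) (by omega)]
      exact z3.trans x2
    | 2, _ => exact z4.trans x3
    | r + 3, hr =>
      rw [f4 _ (by omega) (by omega), f3 _ (by omega), f2 _ (by omega), z1 _ hr]
      simp [Regs.ofInputs]
  · rw [f4 _ (by omega) (by omega), f3 _ (by omega), f2 _ (by omega), f1 _ (by omega) (by omega)]
  · rw [x1] at t2; rw [x2] at t3; omega

/-- Missing inputs are empty registers, so key generation is an activation with empty state and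
message. -/
theorem start_append_nil (n : ℕ) (pp : Word) (s : σ) :
    Cfg.start [unary n, pp, [], []] s = Cfg.start [unary n, pp] s := by
  unfold Cfg.start
  congr 1
  funext r
  match r with
  | 0 => rfl
  | 1 => rfl
  | 2 => rfl
  | 3 => rfl
  | r + 4 => simp [Regs.ofInputs]

/-- The cost of a query of the adversary whose running time is bounded by `TB`. -/
def queryCost (m : ℕ) (F : Polynomial ℕ) (n : ℕ) (pp : Word) (T TB : ℕ) : ℕ :=
  6 + 2 * TB + activationCost m F n pp T

/-- The cost of the reduction, where `T` and `TB` bound the running times of the simulator and of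
the adversary. -/
def reductionCost (m a b : ℕ) (F : Polynomial ℕ) (n : ℕ) (pp : Word) (T TB : ℕ) : ℕ :=
  (10 + n + pushPowCost n 1 + pushPowCost (n + 2) a + pushPowCost (n + 2) b) +
  (3 + 2 * (n + 2) ^ b + (n + 2) ^ b * (7 + 6 * (n + 2) ^ b)) + 2 * activationCost m F n pp T +
  (4 + 10 * (n + 2) ^ a) + (m + 6 + n + pp.length) + (queryCost m F n pp T TB + 1) * TB

/-- Correctness and cost of the reduction in a single coupling. It holds for every oracle `O`: the
cost is used for all oracles in `reduction_ppt`, the output only for the challenge oracle in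
`randGame_reduction`. -/
theorem reduction_coupled {N : NIZK} {D : Simulator} {B : Prog} {m a b n T TB : ℕ}
    {F : Polynomial ℕ} (hF : ProverCost N m F) (hm : 2 ≤ m) (hD : D.RegsLt m) (hB : B.RegsLt m)
    {pp : Word} (hT : D.TimeBound n pp T)
    (hTB : ∀ pk : Word, pk.length ≤ (n + 2) ^ a → B.TimeBound [unary n, pp, pk] TB)
    (hn : (c.regs 0).length = n) (hpp : c.regs 1 = pp) :
    Coupled (fun c' v => decide (c'.regs 0 = [true]) = v ∧
        c'.time ≤ c.time + reductionCost m a b F n pp T TB)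
      ((reduction N D B m a b).run O c)
      ((uniformBelow ((n + 2) ^ b).size).bind fun i =>
        simExperiment (N.gameProver O pp) (i, false, c.env) D B n pp ((n + 2) ^ a)) := by
  unfold reduction
  refine (reaches_initCode a b hn).seq_coupled ?_
  rintro c1 ⟨n1, p1, l1, m1, fl1, st1, ms1, e1, t1⟩
  rw [hpp] at p1
  refine Coupled.bind (sampleCode_coupled m1) ?_
  rintro c2 i ⟨i2, f2, e2, t2⟩
  have rep2 : Represents c2.regs c2 (i, false, c.env) :=
    ⟨e2.trans e1, i2, by rw [f2 _ (by omega) (by omega) (by omega) (by omega) (by omega), fl1]; rfl,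
      fun _ _ => rfl⟩
  have n2 : c2.regs rN = unary n := by
    rw [f2 _ (by omega) (by omega) (by omega) (by omega) (by omega), n1]
  have p2 : c2.regs rPP = pp := by
    rw [f2 _ (by omega) (by omega) (by omega) (by omega) (by omega), p1]
  have l2 : (c2.regs rLen).length = (n + 2) ^ a := by
    rw [f2 _ (by omega) (by omega) (by omega) (by omega) (by omega), l1]
  have hkT : D.keyGen.TimeBound [unary n, pp, [], []] T := by
    intro τ P s d hd
    rw [start_append_nil] at hd
    exact hT.1 τ P s d hd
  have hk := activationCode_coupled (O := O) hF hm hD.1 rep2 n2 p2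
    (by rw [f2 _ (by omega) (by omega) (by omega) (by omega) (by omega), st1])
    (by rw [f2 _ (by omega) (by omega) (by omega) (by omega) (by omega), ms1]) hkT
  rw [start_append_nil] at hk
  refine hk.bind ?_
  rintro c3 k ⟨res3, st3, rep3, t3⟩
  have n3 : c3.regs rN = unary n := (rep3.kept _ (.inr (.inl rfl))).trans n2
  have p3 : c3.regs rPP = pp := (rep3.kept _ (.inr (.inr (.inl rfl)))).trans p2
  have l3 : (c3.regs rLen).length = (n + 2) ^ a := by
    rw [rep3.kept _ (.inr (.inr (.inr rfl))), l2]
  refine reaches_truncateCode.seq_coupled ?_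
  rintro c4 ⟨pk4, f4, e4, t4⟩
  rw [l3] at pk4 t4
  rw [res3] at pk4
  refine (reaches_startCode m).seq_coupled ?_
  rintro c5 ⟨in5, f5, e5, t5⟩
  have n4 : c4.regs rN = unary n := by rw [f4 _ (by omega) (by omega) (by omega) (by omega), n3]
  have p4 : c4.regs rPP = pp := by rw [f4 _ (by omega) (by omega) (by omega) (by omega), p3]
  rw [n4, p4, pk4] at in5
  rw [n4, p4] at t5
  have frame5 : ∀ r, (r = rN ∨ r = rPP ∨ r = rSt ∨ r = rIdx ∨ r = rFlag) →
      c5.regs r = c3.regs r := fun r hr => by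
    rw [f5 r (by omega) (by omega) (by omega), f4 r (by omega) (by omega) (by omega) (by omega)]
  have sim3 : RepresentsSim n pp c3 (k.regs 1, k.env) :=
    ⟨⟨rep3.env, rep3.idx, rep3.flag, fun _ _ => rfl⟩, n3, p3, st3⟩
  have sim5 := sim3.of_frame (e5.trans e4) frame5
  -- The adversary's time bound depends on the length of its input, hence on that of the keys, which
  -- only the truncation bounds for an arbitrary oracle.
  set pk := (k.regs 0).take ((n + 2) ^ a) with hpk
  have hTB' := hTB pk (by rw [hpk]; exact List.length_take_le _ _)
  have simB := inline_coupled (O := O) (O' := D.statefulOracle (N.gameProver O pp) n pp) (k := 1)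
    (m := m) (T := TB) (F := queryCost m F n pp T TB + 1) (K := c5.time) (h := queryCode N D m)
    (Inv := RepresentsSim n pp) (by omega)
    (fun c c' s he hr h => h.of_frame he fun r hk => hr r (by omega))
    (fun c' s' args res _ hI htot => by
      refine (queryCode_coupled hF hm hD hT hI).mono ?_
      rintro c'' a ⟨g1, g2, g3, g4⟩
      refine ⟨g1, fun r hr => g2 r hr, g3, g4.trans ?_⟩
      unfold queryCost
      omega)
    hB (c := c5) (d := Cfg.start [unary n, pp, pk] (k.regs 1, k.env)) fun _ =>
      ⟨in5, sim5, by simp [Cfg.start]⟩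
  refine Coupled.bind (R := fun c' d => c'.regs 1 = d.regs 0 ∧ RepresentsSim n pp c' d.env ∧
    c'.time ≤ c5.time + (queryCost m F n pp T TB + 1) * TB) ?_ ?_
  · refine simB.mono_support ?_
    rintro c' d h - hd
    have hdT := hTB' _ _ _ d hd
    obtain ⟨h1, h2, h3⟩ := h hdT
    exact ⟨h1 0 (by omega), h2, h3.trans (Nat.add_le_add_left (Nat.mul_le_mul_left _ hdT) _)⟩
  · rintro c6 d ⟨h1, h2, h3⟩
    refine (reaches_move _ _ (by omega)).seq_coupled ?_
    rintro c7 ⟨x7, -, f7, e7, t7⟩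
    have sim7 : RepresentsSim n pp c7 d.env :=
      h2.of_frame e7 fun r hr => f7 r (by omega) (by omega)
    obtain ⟨rep7, n7, p7, st7⟩ := sim7
    refine Coupled.bind (activationCode_coupled (O := O) hF hm hD.2.2.2 rep7 n7 p7 st7
      (x7.trans h1) (hT.2 _ _).2.2) ?_
    rintro c8 v ⟨x8, -, -, t8⟩
    refine Reaches.coupled ((reaches_move _ _ (by omega)).mono ?_)
    rintro c9 ⟨x9, -, -, -, t9⟩
    refine ⟨by rw [x9, x8], ?_⟩
    simp only [unary, List.length_replicate] at t5
    unfold reductionCost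
    unfold activationCost
    omega

end

/-! ### The reduction runs in polynomial time -/

/-- Functions that are bounded by a polynomial. -/
def PolyBounded (g : ℕ → ℕ) : Prop := ∃ f : Polynomial ℕ, ∀ m, g m ≤ f.eval m

namespace PolyBounded

variable {g h : ℕ → ℕ}

theorem const (k : ℕ) : PolyBounded fun _ => k := ⟨Polynomial.C k, fun m => by simp⟩

theorem id : PolyBounded fun m => m := ⟨Polynomial.X, fun m => by simp⟩

theorem add (hg : PolyBounded g) (hh : PolyBounded h) : PolyBounded fun m => g m + h m := by
  obtain ⟨f, hf⟩ := hg
  obtain ⟨f', hf'⟩ := hh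
  exact ⟨f + f', fun m => by rw [Polynomial.eval_add]; exact Nat.add_le_add (hf m) (hf' m)⟩

theorem mul (hg : PolyBounded g) (hh : PolyBounded h) : PolyBounded fun m => g m * h m := by
  obtain ⟨f, hf⟩ := hg
  obtain ⟨f', hf'⟩ := hh
  exact ⟨f * f', fun m => by rw [Polynomial.eval_mul]; exact Nat.mul_le_mul (hf m) (hf' m)⟩

theorem pow (hg : PolyBounded g) (k : ℕ) : PolyBounded fun m => g m ^ k := by
  obtain ⟨f, hf⟩ := hg
  exact ⟨f ^ k, fun m => by rw [Polynomial.eval_pow]; exact Nat.pow_le_pow_left (hf m) k⟩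

theorem eval (p : Polynomial ℕ) (hg : PolyBounded g) : PolyBounded fun m => p.eval (g m) := by
  obtain ⟨f, hf⟩ := hg
  exact ⟨p.comp f, fun m => by rw [Polynomial.eval_comp]; exact poly_eval_mono p (hf m)⟩

theorem pushPowCost (hg : PolyBounded g) (k : ℕ) :
    PolyBounded fun m => ZkFaith.pushPowCost (g m) k := by
  induction k with
  | zero => exact const 1
  | succ k ih => exact ((const 1).add hg).add (hg.mul ih)

/-- The cost depends on the parameters only through their length, so `unary (l m)` stands for any
parameters of length `l m`. -/
theorem activationCost (k : ℕ) (F : Polynomial ℕ) {n l T : ℕ → ℕ} (hn : PolyBounded n)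
    (hl : PolyBounded l) (hT : PolyBounded T) :
    PolyBounded fun m => ZkFaith.activationCost k F (n m) (unary (l m)) (T m) := by
  unfold ZkFaith.activationCost unary
  simp only [List.length_replicate]
  exact ((((const _).add (const _)).add hn).add hl).add
    (((eval F (hl.add hT)).add (const 1)).mul hT)

theorem reductionCost (k a b : ℕ) (F : Polynomial ℕ) {n l T TB : ℕ → ℕ} (hn : PolyBounded n)
    (hl : PolyBounded l) (hT : PolyBounded T) (hTB : PolyBounded TB) :
    PolyBounded fun m => ZkFaith.reductionCost k a b F (n m) (unary (l m)) (T m) (TB m) := by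
  have ha := activationCost k F hn hl hT
  have hn2 := hn.add (const 2)
  have hM := hn2.pow b
  unfold ZkFaith.reductionCost ZkFaith.queryCost unary
  simp only [List.length_replicate]
  exact (((((((((const 10).add hn).add (pushPowCost hn 1)).add (pushPowCost hn2 a)).add
    (pushPowCost hn2 b)).add (((const 3).add ((const 2).mul hM)).add
    (hM.mul ((const 7).add ((const 6).mul hM))))).add ((const 2).mul ha)).add
    ((const 4).add ((const 10).mul (hn2.pow a)))).add
    ((((const k).add (const 6)).add hn).add hl)).add
    (((((const 6).add ((const 2).mul hTB)).add ha).add (const 1)).mul hTB)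

end PolyBounded

theorem pushPowCost_mono (k : ℕ) : Monotone fun b => pushPowCost b k := by
  intro b b' h
  induction k with
  | zero => exact le_rfl
  | succ k ih => exact Nat.add_le_add (Nat.add_le_add_left h 1) (Nat.mul_le_mul h ih)

theorem activationCost_mono (k : ℕ) (F : Polynomial ℕ) {n n' T T' : ℕ} {pp pp' : Word}
    (hn : n ≤ n') (hp : pp.length ≤ pp'.length) (hT : T ≤ T') :
    activationCost k F n pp T ≤ activationCost k F n' pp' T' := by
  have hF : F.eval (pp.length + T) ≤ F.eval (pp'.length + T') :=
    poly_eval_mono F (Nat.add_le_add hp hT)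
  unfold activationCost
  gcongr

theorem reductionCost_mono (k a b : ℕ) (F : Polynomial ℕ) {n n' T T' TB TB' : ℕ} {pp pp' : Word}
    (hn : n ≤ n') (hp : pp.length ≤ pp'.length) (hT : T ≤ T') (hTB : TB ≤ TB') :
    reductionCost k a b F n pp T TB ≤ reductionCost k a b F n' pp' T' TB' := by
  have ha := activationCost_mono k F hn hp hT
  have h1 : pushPowCost n 1 ≤ pushPowCost n' 1 := pushPowCost_mono 1 hn
  have h2 : pushPowCost (n + 2) a ≤ pushPowCost (n' + 2) a :=
    pushPowCost_mono a (Nat.add_le_add_right hn 2)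
  have h3 : pushPowCost (n + 2) b ≤ pushPowCost (n' + 2) b :=
    pushPowCost_mono b (Nat.add_le_add_right hn 2)
  unfold reductionCost queryCost
  gcongr

/-- The time bounds of the simulator for given parameters. -/
theorem Simulator.PPT.timeBound {D : Simulator} (hD : D.PPT) :
    ∃ f : Polynomial ℕ, ∀ n pp, D.TimeBound n pp (f.eval (n + pp.length)) := hD

theorem Prog.TimeBound.mono {p : Prog} {inputs : List Word} {t t' : ℕ} (h : p.TimeBound inputs t)
    (ht : t ≤ t') : p.TimeBound inputs t' := fun σ O s c hc => (h σ O s c hc).trans ht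

/-- Each final configuration has a partner in the coupling `reduction_coupled`, and that coupling
bounds its time. -/
theorem reduction_ppt {N : NIZK} {D : Simulator} {B : Prog} {m : ℕ} (a b : ℕ)
    {F : Polynomial ℕ} (hF : ProverCost N m F) (hm : 2 ≤ m) (hD : D.RegsLt m) (hB : B.RegsLt m)
    (hDT : D.PPT) (hBT : B.PPT) : (reduction N D B m a b).PPT := by
  obtain ⟨f, hf⟩ := hDT.timeBound
  obtain ⟨g, hg⟩ := hBT
  -- Here `l` is the total input length, which bounds both the security parameter and the length of
  -- the parameters.
  have hT : PolyBounded fun l => f.eval (l + l) := .eval f (.add .id .id)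
  have hTB : PolyBounded fun l => g.eval (l + l + (l + 2) ^ a) :=
    .eval g (.add (.add .id .id) (.pow (.add .id (.const 2)) a))
  obtain ⟨p, hp⟩ := PolyBounded.reductionCost m a b F .id .id hT hTB
  refine ⟨p, fun inputs σ O s c hc => ?_⟩
  set n := (Regs.ofInputs inputs 0).length with hn
  set pp := Regs.ofInputs inputs 1 with hpp
  have hnl : n ≤ totalLength inputs := ofInputs_length_le _ _
  have hpl : pp.length ≤ totalLength inputs := ofInputs_length_le _ _
  obtain ⟨v, -, -, hv⟩ := (reduction_coupled (O := O) (c := Cfg.start inputs s) (n := n) (a := a)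
    (b := b) (pp := pp) (TB := g.eval (n + pp.length + (n + 2) ^ a)) hF hm hD hB (hf n pp)
    (fun pk hpk => (hg _).mono (poly_eval_mono g (by
      simp only [totalLength, unary, List.map_cons, List.map_nil, List.sum_cons, List.sum_nil,
        List.length_replicate]
      omega))) hn.symm rfl).exists_of_mem hc
  refine hv.trans (le_trans ?_ (hp (totalLength inputs)))
  have hz : (Cfg.start inputs s).time = 0 := rfl
  rw [hz, Nat.zero_add]
  refine reductionCost_mono m a b F hnl (by simpa [unary] using hpl)
    (poly_eval_mono f (Nat.add_le_add hnl hpl)) (poly_eval_mono g ?_)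
  gcongr

/-! ### Comparing experiments with different provers -/

section

variable {σ τ : Type}

theorem antitone_of_succ {E : ℕ → σ → τ → Prop} (hE : ∀ k s t, E (k + 1) s t → E k s t)
    {k k' : ℕ} (h : k ≤ k') {s : σ} {t : τ} (hk : E k' s t) : E k s t := by
  induction k', h using Nat.le_induction with
  | base => exact hk
  | succ k' _ ih => exact ih (hE _ _ _ hk)

variable {P₁ : Oracle σ} {P₂ : Oracle τ} {E : ℕ → σ → τ → Prop}

/-- An activation that takes at most `T` steps uses up at most `T` of the calls for which the
provers agree. -/
theorem activation_coupled (hE : ∀ k s t, E (k + 1) s t → E k s t)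
    (hP : ∀ k args s t, E (k + 1) s t →
      Coupled (fun a b => a.1 = b.1 ∧ E k a.2 b.2) (P₁ args s) (P₂ args t))
    {p : Prog} {inputs : List Word} {T r : ℕ} (hT : p.TimeBound inputs T) {s : σ} {t : τ}
    (h : E (r + T) s t) :
    Coupled (fun c d => c.regs = d.regs ∧ E r c.env d.env)
      (p.run P₁ (Cfg.start inputs s)) (p.run P₂ (Cfg.start inputs t)) := by
  refine (run_coupled (T := T) (E := fun u s t => E (r + (T - u)) s t) ?_ ?_ p
    (c₁ := Cfg.start inputs s) (c₂ := Cfg.start inputs t) fun _ => ⟨rfl, rfl, h⟩).mono_support ?_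
  · exact fun u u' s t hu h => antitone_of_succ hE (by omega) h
  · intro u args s t hu h
    exact hP _ _ _ _ (antitone_of_succ hE (by omega) h)
  · rintro c d hcd - hd
    obtain ⟨h1, -, h3⟩ := hcd (hT _ _ _ _ hd)
    exact ⟨h1, antitone_of_succ hE (by omega) h3⟩

/-- Read `E k` as: the provers agree for at least `k` more calls. Key generation and "show" make at
most `T` calls each, and each of the at most `TB` queries makes at most `T`. Provers that agree
forever are covered by a relation that does not depend on `k`. -/
theorem simExperiment_congr (hE : ∀ k s t, E (k + 1) s t → E k s t)
    (hP : ∀ k args s t, E (k + 1) s t →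
      Coupled (fun a b => a.1 = b.1 ∧ E k a.2 b.2) (P₁ args s) (P₂ args t))
    {D : Simulator} {B : Prog} {n L T TB : ℕ} {pp : Word} (hT : D.TimeBound n pp T)
    (hTB : ∀ pk : Word, pk.length ≤ L → B.TimeBound [unary n, pp, pk] TB) {s : σ} {t : τ}
    (h : E (T + T * TB + T) s t) :
    simExperiment P₁ s D B n pp L = simExperiment P₂ t D B n pp L := by
  unfold simExperiment
  refine (activation_coupled hE hP hT.1 h).bind_eq ?_
  rintro k l ⟨hkl, hE1⟩ - -
  rw [hkl]
  -- After `u` steps the adversary has at most `TB - u` queries left, with `T` calls each; the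
  -- additional `T` is reserved for "show".
  have hB := run_coupled (O₁ := D.statefulOracle P₁ n pp) (O₂ := D.statefulOracle P₂ n pp)
    (E := fun u s t => s.1 = t.1 ∧ E (T + T * (TB - u)) s.2 t.2) (T := TB) ?_ ?_ B
    (c₁ := Cfg.start [unary n, pp, (l.regs 0).take L] (l.regs 1, k.env))
    (c₂ := Cfg.start [unary n, pp, (l.regs 0).take L] (l.regs 1, l.env))
    fun _ => ⟨rfl, rfl, rfl, hE1⟩
  · refine hB.bind_eq ?_
    rintro c d hcd - hd
    obtain ⟨h1, -, h2, h3⟩ := hcd (hTB _ (List.length_take_le _ _) _ _ _ _ hd)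
    rw [h1, h2]
    refine (activation_coupled hE hP (hT.2 _ _).2.2 (r := 0)
      (antitone_of_succ hE (by omega) h3)).map_eq ?_
    rintro v w ⟨hvw, -⟩
    rw [hvw]
  · rintro u u' s t hu ⟨h1, h2⟩
    refine ⟨h1, antitone_of_succ hE (Nat.add_le_add_left (Nat.mul_le_mul_left _ ?_) _) h2⟩
    omega
  · rintro u args s t hu ⟨h1, h2⟩
    -- A query advances the clock by at least one, which releases the `T` calls it may need.
    have hle : T + T * (TB - (u + 1 + totalLength args)) + T ≤ T + T * (TB - u) := by
      have : T * (TB - (u + 1 + totalLength args) + 1) ≤ T * (TB - u) :=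
        Nat.mul_le_mul_left _ (by omega)
      rw [Nat.mul_add, Nat.mul_one] at this
      omega
    unfold Simulator.statefulOracle
    rw [h1]
    have hreq := hT.2 t.1 (args.getD 1 [])
    refine (activation_coupled hE hP ?_ (antitone_of_succ hE hle h2)).map ?_
    · split_ifs
      · exact hreq.2.1
      · exact hreq.1
    · rintro c d ⟨hcd, h3⟩
      exact ⟨by simp [hcd], by simp [hcd], h3⟩

end

/-! ### Provers that randomize a given number of proofs -/

namespace NIZK

variable {N : NIZK} {pp : Word}

/-- The prover that randomizes the first proofs, as many as its state says. -/
def countProver (N : NIZK) (pp : Word) : Oracle ℕ := fun args j =>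
  let x := args.getD 0 []
  let w := args.getD 1 []
  if N.rel pp x w = true then
    (N.prove.out [pp, x, w]).bind fun π =>
      if 0 < j then (N.rand.out [pp, x, π]).map fun π' => (π', j - 1) else PMF.pure (π, j)
  else PMF.pure ([], j)

theorem freshProofs_coupled (args : List Word) {j : ℕ} (hj : j = 0) :
    Coupled (fun a b => a.1 = b.1 ∧ b.2 = 0) (N.freshProofs pp args ()) (N.countProver pp args j) := by
  subst hj
  simp only [freshProofs, countProver, lt_irrefl, if_false]
  split_ifs
  · exact (Coupled.refl _).map fun a b h => ⟨h, rfl⟩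
  · exact .pure ⟨rfl, rfl⟩

theorem randomizedProofs_coupled (args : List Word) {j k : ℕ} (hj : k + 1 ≤ j) :
    Coupled (fun a b => a.1 = b.1 ∧ k ≤ b.2)
      (N.randomizedProofs pp args ()) (N.countProver pp args j) := by
  have hpos : 0 < j := by omega
  simp only [randomizedProofs, countProver, if_pos hpos]
  split_ifs
  · refine (Coupled.refl _).bind ?_
    rintro π _ rfl
    exact (Coupled.refl _).map fun a b h => ⟨h, by simp only; omega⟩
  · exact .pure ⟨rfl, by simp only; omega⟩

/-- The states of `gameProver`, with the challenge for the bit `β`, and of `countProver` that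
correspond to each other. -/
def SameCount (β : Bool) (s : ℕ × Bool × Bool) (j : ℕ) : Prop :=
  s.2.1 = s.2.2 ∧ if s.2.1 then s.1 = 0 ∧ j = 0 else j = s.1 + β.toNat

/-- Before the challenge, the proofs still to be randomized are those of the counter and, if `β` is
true, the challenge itself; afterwards there are none. Calls outside the relation change neither
count. -/
theorem gameProver_coupled (hN : N.Complete) {n : ℕ} (hpp : pp ∈ (N.setup.out [unary n]).support)
    {β : Bool} (args : List Word) {s : ℕ × Bool × Bool} {j : ℕ} (hs : SameCount β s j) :
    Coupled (fun a b => a.1 = b.1 ∧ SameCount β a.2 b.2)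
      (N.gameProver (N.challenge β pp) pp args s) (N.countProver pp args j) := by
  obtain ⟨i, used, u⟩ := s
  obtain ⟨h1, h2⟩ := hs
  simp only at h1 h2
  subst h1
  simp only [gameProver, countProver]
  generalize args.getD 0 [] = x
  generalize args.getD 1 [] = w
  by_cases hrel : N.rel pp x w = true
  swap
  · simp only [if_neg hrel]
    exact .pure ⟨rfl, rfl, h2⟩
  simp only [if_pos hrel]
  by_cases hi : 0 < i
  · cases used with
    | true => simp at h2; omega
    | false =>
      simp only [Bool.false_eq_true, if_false] at h2
      have hj : 0 < j := by omega
      simp only [if_pos hi, if_pos hj]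
      refine (Coupled.refl _).bind ?_
      rintro π _ rfl
      refine (Coupled.refl _).map ?_
      rintro a _ rfl
      refine ⟨rfl, rfl, ?_⟩
      simp only [Bool.false_eq_true, if_false]
      omega
  simp only [if_neg hi]
  cases used with
  | true =>
    simp only [if_true] at h2
    obtain ⟨rfl, rfl⟩ := h2
    simp only [lt_irrefl, if_false, Bool.true_eq_false]
    refine (Coupled.refl _).bind ?_
    rintro π _ rfl
    exact .pure ⟨rfl, rfl, by simp⟩
  | false =>
    simp only [Bool.false_eq_true, if_false] at h2
    have hi0 : i = 0 := by omega
    subst hi0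
    simp only [if_true]
    -- By perfect completeness the submitted proof is accepted, so the challenge never takes its
    -- rejecting branch.
    have hch : ∀ π ∈ (N.prove.out [pp, x, w]).support,
        (N.challenge β pp [x, w, π] false).map (fun a => (a.1, (0, true, a.2))) =
          (if β then N.rand.out [pp, x, π] else N.prove.out [pp, x, w]).map
            fun π' => (π', ((0 : ℕ), true, true)) := by
      intro π hπ
      have hv := hN n pp hpp x w hrel π hπ
      simp only [challenge, List.getD_cons_zero, List.getD_cons_succ, hrel, hv, PMF.pure_bind,
        and_self, if_true, PMF.map_comp]
      rfl
    rw [bind_congr_support hch]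
    cases β with
    | true =>
      simp only [Bool.toNat_true, Nat.zero_add] at h2
      subst h2
      simp only [if_true, Nat.one_pos]
      refine (Coupled.refl _).bind ?_
      rintro π _ rfl
      refine (Coupled.refl _).map ?_
      rintro a _ rfl
      exact ⟨rfl, rfl, by simp⟩
    | false =>
      simp only [Bool.toNat_false, Nat.zero_add] at h2
      subst h2
      -- The challenge is a new proof that does not depend on the submitted one, which is averaged
      -- out.
      simp only [lt_irrefl, if_false, Bool.false_eq_true, PMF.bind_const]
      refine (Coupled.refl _).map ?_
      rintro a _ rfl
      exact ⟨rfl, rfl, by simp⟩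

end NIZK

/-! ### The privacy experiment in terms of `simExperiment` -/

/-- Truncation does nothing to keys of length at most `L`, and a prover without memory adds only a
trivial component to the state of the oracle. -/
theorem privacyExperiment_eq {N : NIZK} {prover : Word → Oracle Unit} {D : Simulator} {B : Prog}
    {n L : ℕ} (hB : B.PPT)
    (hL : ∀ pp ∈ (N.setup.out [unary n]).support,
      ∀ k ∈ (D.keyGen.run (prover pp) (Cfg.start [unary n, pp] ())).support,
        (k.regs 0).length ≤ L) :
    privacyExperiment N prover D B n =
      (N.setup.out [unary n]).bind fun pp => simExperiment (prover pp) () D B n pp L := by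
  obtain ⟨g, hg⟩ := hB
  refine bind_congr_support fun pp hpp => ?_
  unfold simExperiment activate
  rw [PMF.bind_map]
  refine bind_congr_support fun k hk => ?_
  simp only [Function.comp]
  rw [List.take_of_length_le (hL pp hpp k hk)]
  refine (run_coupled (O₁ := D.oracle (prover pp) n pp) (O₂ := D.statefulOracle (prover pp) n pp)
    (E := fun _ s t => s = t.1) (T := g.eval (totalLength [unary n, pp, k.regs 0])) (fun _ _ _ _ _ h => h) ?_ B
    (c₁ := Cfg.start [unary n, pp, k.regs 0] (k.regs 1))
    (c₂ := Cfg.start [unary n, pp, k.regs 0] (k.regs 1, k.env))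
    fun _ => ⟨rfl, rfl, rfl⟩).bind_eq ?_
  · rintro u args s t - rfl
    exact (Coupled.refl _).map fun a b h => by subst h; exact ⟨rfl, rfl⟩
  · rintro c d hcd - hd
    obtain ⟨h1, -, h3⟩ := hcd (hg _ _ _ _ _ hd)
    rw [PMF.map_comp, h1, h3]
    rfl

/-! ### Averages over the index of the challenge -/

theorem sum_range_two_mul (n : ℕ) (h : ℕ → ℝ) :
    ∑ i ∈ Finset.range (2 * n), h i = ∑ i ∈ Finset.range n, (h (2 * i) + h (2 * i + 1)) := by
  induction n with
  | zero => simp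
  | succ n ih =>
    rw [Nat.mul_succ, Finset.sum_range_succ, Finset.sum_range_succ, ih, Finset.sum_range_succ]
    ring

theorem prOne_bind_uniformBool (f : Bool → PMF Bool) :
    prOne ((PMF.uniformOfFintype Bool).bind f) = (prOne (f false) + prOne (f true)) / 2 := by
  unfold prOne
  rw [PMF.bind_apply, tsum_fintype, Fintype.sum_bool]
  simp only [PMF.uniformOfFintype_apply, Fintype.card_bool]
  rw [ENNReal.toReal_add (ENNReal.mul_ne_top (by simp) (PMF.apply_ne_top _ _))
    (ENNReal.mul_ne_top (by simp) (PMF.apply_ne_top _ _)), ENNReal.toReal_mul, ENNReal.toReal_mul]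
  simp
  ring

theorem prOne_bind_uniformBelow (k : ℕ) (f : ℕ → PMF Bool) :
    prOne ((uniformBelow k).bind f) = (∑ i ∈ Finset.range (2 ^ k), prOne (f i)) / 2 ^ k := by
  induction k generalizing f with
  | zero => simp [uniformBelow]
  | succ k ih =>
    have : (uniformBelow (k + 1)).bind f = (uniformBelow k).bind fun i =>
        (PMF.uniformOfFintype Bool).bind fun b => f (2 * i + b.toNat) := by
      simp only [uniformBelow, PMF.bind_bind, PMF.bind_map]
      rfl
    rw [this, ih, pow_succ, Nat.mul_comm, sum_range_two_mul, pow_succ, div_mul_eq_div_div_swap]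
    simp only [prOne_bind_uniformBool, Bool.toNat_false, Bool.toNat_true, Nat.add_zero,
      ← Finset.sum_div]

/-- The telescoping sum of the hybrid argument. -/
theorem prOne_hybrids (k : ℕ) (f : ℕ → PMF Bool) :
    2 ^ k * (prOne ((uniformBelow k).bind fun i => f (i + 1)) - prOne ((uniformBelow k).bind f)) =
      prOne (f (2 ^ k)) - prOne (f 0) := by
  rw [prOne_bind_uniformBelow, prOne_bind_uniformBelow, ← sub_div, ← Finset.sum_sub_distrib,
    Finset.sum_range_sub (fun i => prOne (f i)), mul_div_cancel₀ _ (by positivity)]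

/-! ### Lengths in the experiment -/

theorem NIZK.exists_answer_bound (N : NIZK) : ∃ A : Polynomial ℕ, ∀ (pp : Word) (args : List Word),
    (∀ a ∈ (N.freshProofs pp args ()).support,
      a.1.length ≤ A.eval (pp.length + totalLength args)) ∧
    ∀ a ∈ (N.randomizedProofs pp args ()).support,
      a.1.length ≤ A.eval (pp.length + totalLength args) := by
  obtain ⟨fp, hfp⟩ := N.prove_ppt
  obtain ⟨fr, hfr⟩ := N.rand_ppt
  let X2 : Polynomial ℕ := 2 * Polynomial.X
  let V : Polynomial ℕ := 2 * X2 + fp.comp X2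
  refine ⟨V + fr.comp V, fun pp args => ?_⟩
  set u := pp.length + totalLength args with hu
  set v := 2 * (2 * u) + fp.eval (2 * u) with hv
  have hA : (V + fr.comp V).eval u = v + fr.eval v := by simp [X2, V, hv, Polynomial.eval_comp]
  rw [hA]
  have tot : ∀ a b d : Word, totalLength [a, b, d] = a.length + b.length + d.length := by
    intro a b d; simp [totalLength, Nat.add_assoc]
  have lx := length_getD_le_totalLength args 0
  have lw := length_getD_le_totalLength args 1
  have lin := tot pp (args.getD 0 []) (args.getD 1 [])
  have hprove : ∀ π ∈ (N.prove.out [pp, args.getD 0 [], args.getD 1 []]).support,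
      π.length ≤ 2 * u + fp.eval (2 * u) := fun π hπ => by
    have h1 := length_le_of_mem_out (hfp _) hπ
    have h2 : fp.eval (totalLength [pp, args.getD 0 [], args.getD 1 []]) ≤ fp.eval (2 * u) :=
      poly_eval_mono fp (by omega)
    omega
  constructor
  · intro a ha
    simp only [freshProofs] at ha
    split_ifs at ha
    · obtain ⟨π, hπ, rfl⟩ := (PMF.mem_support_map_iff _ _ _).1 ha
      have := hprove π hπ
      simp only
      omega
    · simp only [PMF.support_pure, Set.mem_singleton_iff] at ha
      simp [ha]
  · intro a ha
    simp only [randomizedProofs] at ha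
    split_ifs at ha
    · obtain ⟨π, hπ, ha⟩ := (PMF.mem_support_bind_iff _ _ _).1 ha
      obtain ⟨π', hπ', rfl⟩ := (PMF.mem_support_map_iff _ _ _).1 ha
      have h0 := hprove π hπ
      have h1 := length_le_of_mem_out (hfr _) hπ'
      have h3 := tot pp (args.getD 0 []) π
      have h2 : fr.eval (totalLength [pp, args.getD 0 [], π]) ≤ fr.eval v :=
        poly_eval_mono fr (by omega)
      simp only
      omega
    · simp only [PMF.support_pure, Set.mem_singleton_iff] at ha
      simp [ha]

/-- Registers grow by one bit per step or receive an answer, and within `T` steps the arguments of a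
call have length at most `T`. -/
theorem keyGen_length_le {P : Oracle Unit} {A : Polynomial ℕ} {D : Simulator} {n T : ℕ} {pp : Word}
    (hA : ∀ args, ∀ a ∈ (P args ()).support, a.1.length ≤ A.eval (pp.length + totalLength args))
    (hT : D.TimeBound n pp T) {k : Cfg Unit}
    (hk : k ∈ (D.keyGen.run P (Cfg.start [unary n, pp] ())).support) :
    (k.regs 0).length ≤ n + pp.length + A.eval (pp.length + T) + T := by
  have hkT := hT.1 _ _ _ k hk
  have := length_le_of_mem_run (L := n + pp.length + A.eval (pp.length + T)) (T := T)
    (fun args s hargs a ha => ?_) D.keyGen (fun r => ?_) hk hkT 0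
  · omega
  · have h1 := hA args a ha
    have h2 : A.eval (pp.length + totalLength args) ≤ A.eval (pp.length + T) :=
      poly_eval_mono A (by omega)
    omega
  · have h1 := ofInputs_length_le [unary n, pp] r
    simp only [totalLength, unary, List.map_cons, List.map_nil, List.sum_cons, List.sum_nil,
      List.length_replicate] at h1
    simp only [Cfg.start, unary]
    omega

theorem PolyBounded.exists_le_pow {g : ℕ → ℕ} (hg : PolyBounded g) :
    ∃ k, ∀ m, g m ≤ (m + 2) ^ k := by
  obtain ⟨f, hf⟩ := hg
  obtain ⟨k, hk⟩ := exists_poly_le_pow f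
  exact ⟨k, fun m => (hf m).trans (hk m)⟩

/-! ### The hybrid argument -/

/-- The privacy experiment in which the first `j` proofs are randomized. -/
def hybrid (N : NIZK) (B : Prog) (D : Simulator) (a n j : ℕ) : PMF Bool :=
  (N.setup.out [unary n]).bind fun pp =>
    simExperiment (N.countProver pp) j D B n pp ((n + 2) ^ a)

/-- Bounds on the lengths of the public keys and on the number of proofs in the experiments. -/
theorem exists_hybrid_bounds (N : NIZK) {B : Prog} (hB : B.PPT) {D : Simulator} (hD : D.PPT) :
    ∃ a b, ∀ n, UPri N B D n = hybrid N B D a n 0 ∧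
      ∀ j, (n + 2) ^ b ≤ j → UPriModified N B D n = hybrid N B D a n j := by
  obtain ⟨s, hs⟩ := N.setup_ppt
  obtain ⟨f, hf⟩ := hD.timeBound
  obtain ⟨g, hg⟩ := id hB
  obtain ⟨A, hA⟩ := N.exists_answer_bound
  let S : ℕ → ℕ := fun n => n + s.eval n
  let T : ℕ → ℕ := fun n => f.eval (n + S n)
  have hS : PolyBounded S := .add .id (.eval s .id)
  have hT : PolyBounded T := .eval f (.add .id hS)
  obtain ⟨a, ha⟩ := PolyBounded.exists_le_pow
    (g := fun n => n + S n + A.eval (S n + T n) + T n)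
    (((PolyBounded.id.add hS).add (.eval A (hS.add hT))).add hT)
  -- The exponent `a` for the keys is chosen first, since it enters the adversary's time and thereby
  -- the number of proofs, which determines `b`.
  let TB : ℕ → ℕ := fun n => g.eval (n + S n + (n + 2) ^ a)
  have hTB : PolyBounded TB :=
    .eval g ((PolyBounded.id.add hS).add ((PolyBounded.id.add (.const 2)).pow a))
  obtain ⟨b, hb⟩ := PolyBounded.exists_le_pow (g := fun n => T n + T n * TB n + T n)
    ((hT.add (hT.mul hTB)).add hT)
  have hpp : ∀ n, ∀ pp ∈ (N.setup.out [unary n]).support, pp.length ≤ S n := fun n pp h => by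
    have := length_le_of_mem_out (hs _) h
    simpa [totalLength, unary, S] using this
  have hDT : ∀ n, ∀ pp ∈ (N.setup.out [unary n]).support, D.TimeBound n pp (T n) :=
    fun n pp h => by
    have hle : f.eval (n + pp.length) ≤ T n := poly_eval_mono f (Nat.add_le_add_left (hpp n pp h) n)
    exact ⟨(hf n pp).1.mono hle, fun st msg => ⟨((hf n pp).2 st msg).1.mono hle,
      ((hf n pp).2 st msg).2.1.mono hle, ((hf n pp).2 st msg).2.2.mono hle⟩⟩
  have hBT : ∀ n, ∀ pp ∈ (N.setup.out [unary n]).support, ∀ pk : Word,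
      pk.length ≤ (n + 2) ^ a → B.TimeBound [unary n, pp, pk] (TB n) := fun n pp h pk hpk => by
    refine (hg _).mono (poly_eval_mono g ?_)
    have := hpp n pp h
    simp only [totalLength, unary, List.map_cons, List.map_nil, List.sum_cons, List.sum_nil,
      List.length_replicate]
    omega
  have hlen : ∀ (prover : Word → Oracle Unit),
      (∀ pp args, ∀ x ∈ (prover pp args ()).support,
        x.1.length ≤ A.eval (pp.length + totalLength args)) →
      ∀ n, ∀ pp ∈ (N.setup.out [unary n]).support,
      ∀ k ∈ (D.keyGen.run (prover pp) (Cfg.start [unary n, pp] ())).support,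
        (k.regs 0).length ≤ (n + 2) ^ a := by
    intro prover hprover n pp h k hk
    refine (keyGen_length_le (hprover pp) (hDT n pp h) hk).trans (le_trans ?_ (ha n))
    have h1 := hpp n pp h
    have h2 : A.eval (pp.length + T n) ≤ A.eval (S n + T n) :=
      poly_eval_mono A (Nat.add_le_add_right h1 _)
    omega
  refine ⟨a, b, fun n => ⟨?_, fun j hj => ?_⟩⟩
  · unfold UPri hybrid
    rw [privacyExperiment_eq hB (hlen _ (fun pp args => (hA pp args).1) n)]
    refine bind_congr_support fun pp h => ?_
    exact simExperiment_congr (E := fun _ _ j => j = 0) (fun _ _ _ h => h)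
      (fun _ args _ _ h => NIZK.freshProofs_coupled args h) (hDT n pp h) (hBT n pp h) rfl
  · unfold UPriModified hybrid
    rw [privacyExperiment_eq hB (hlen _ (fun pp args => (hA pp args).2) n)]
    refine bind_congr_support fun pp h => ?_
    -- The counting prover agrees with the randomizing one for as many calls as its counter says.
    exact simExperiment_congr (E := fun k _ j => k ≤ j) (fun _ _ _ h => Nat.le_of_succ_le h)
      (fun _ args _ _ h => NIZK.randomizedProofs_coupled args h) (hDT n pp h) (hBT n pp h)
      ((hb n).trans hj)

/-- The reduction plays the experiment with a random number of randomized proofs. -/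
theorem randGame_reduction {N : NIZK} (hN : N.Complete) {B : Prog} (hB : B.PPT) {D : Simulator}
    (hD : D.PPT) {m : ℕ} {F : Polynomial ℕ} (hF : ProverCost N m F) (hm : 2 ≤ m)
    (hDm : D.RegsLt m) (hBm : B.RegsLt m) (a b n : ℕ) (β : Bool) :
    N.randGame (reduction N D B m a b) β n =
      (uniformBelow ((n + 2) ^ b).size).bind fun i => hybrid N B D a n (i + β.toNat) := by
  obtain ⟨f, hf⟩ := hD.timeBound
  obtain ⟨g, hg⟩ := id hB
  unfold NIZK.randGame hybrid
  -- The index is drawn by the reduction after the set-up; being independent of it, it may be drawn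
  -- first.
  rw [PMF.bind_comm]
  refine bind_congr_support fun pp hpp => ?_
  have hTB : ∀ pk : Word, pk.length ≤ (n + 2) ^ a →
      B.TimeBound [unary n, pp, pk] (g.eval (n + pp.length + (n + 2) ^ a)) := fun pk hpk => by
    refine (hg _).mono (poly_eval_mono g ?_)
    simp only [totalLength, unary, List.map_cons, List.map_nil, List.sum_cons, List.sum_nil,
      List.length_replicate]
    omega
  have h := (reduction_coupled (O := N.challenge β pp) (c := Cfg.start [unary n, pp] false)
    (a := a) (b := b) hF hm hDm hBm (hf n pp) hTB (by simp [Cfg.start, Regs.ofInputs, unary])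
    rfl).map_eq (f := fun c => decide (c.regs 0 = [true])) (g := fun v => v) fun _ _ h => h.1
  rw [h]
  refine (PMF.map_id _).trans (congrArg _ (funext fun i => ?_))
  exact simExperiment_congr (E := fun _ s j => NIZK.SameCount β s j) (fun _ _ _ h => h)
    (fun _ args _ _ h => NIZK.gameProver_coupled hN hpp args h) (hf n pp) hTB
    ⟨rfl, by simp⟩

theorem exists_common_bound (N : NIZK) (D : Simulator) (B : Prog) :
    ∃ m, 2 ≤ m ∧ N.RegsLt m ∧ D.RegsLt m ∧ B.RegsLt m := by
  obtain ⟨m1, h1⟩ := N.decideRel.exists_regsLt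
  obtain ⟨m2, h2⟩ := N.prove.exists_regsLt
  obtain ⟨m3, h3⟩ := N.rand.exists_regsLt
  obtain ⟨m4, h4⟩ := D.keyGen.exists_regsLt
  obtain ⟨m5, h5⟩ := D.request.exists_regsLt
  obtain ⟨m6, h6⟩ := D.issue.exists_regsLt
  obtain ⟨m7, h7⟩ := D.showPhase.exists_regsLt
  obtain ⟨m8, h8⟩ := B.exists_regsLt
  exact ⟨2 + m1 + m2 + m3 + m4 + m5 + m6 + m7 + m8, by omega,
    ⟨h1.mono (by omega), h2.mono (by omega), h3.mono (by omega)⟩,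
    ⟨h4.mono (by omega), h5.mono (by omega), h6.mono (by omega), h7.mono (by omega)⟩,
    h8.mono (by omega)⟩

/-! ### Negligible functions. -/

theorem negligible_pow_mul {ν : ℕ → ℝ} (hν : Negligible ν) (b : ℕ) :
    Negligible fun n => 2 * ((n : ℝ) + 2) ^ b * ν n := by
  have := Asymptotics.SuperpolynomialDecay.polynomial_mul hν
    (2 * (Polynomial.X + 2) ^ b : Polynomial ℝ)
  simpa [Negligible] using this

theorem negligible_half_pow : Negligible fun n => (1 / 2 : ℝ) ^ n := fun k =>
  tendsto_pow_const_mul_const_pow_of_abs_lt_one k (by rw [abs_of_pos] <;> norm_num)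

end ZkFaith

end

/-! ### Conclusion: the advantage of the reduction bounds the distance of the experiments. -/

theorem theorem2 (N : ZkFaith.NIZK) (hcomplete : N.Complete) (hrand : N.Randomizable)
    (B : ZkFaith.Prog) (hB : B.PPT) (D : ZkFaith.Simulator) (hD : D.PPT) :
    ∃ negl : ℕ → ℝ, ZkFaith.Negligible negl ∧ ∀ n : ℕ,
      |ZkFaith.prOne (ZkFaith.UPri N B D n) - ZkFaith.prOne (ZkFaith.UPriModified N B D n)|
        < negl n := by
  obtain ⟨m, hm, hNm, hDm, hBm⟩ := ZkFaith.exists_common_bound N D B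
  obtain ⟨F, hF⟩ := ZkFaith.exists_proverCost N (by omega) hNm
  obtain ⟨a, b, hab⟩ := ZkFaith.exists_hybrid_bounds N hB hD
  let A := ZkFaith.reduction N D B m a b
  let adv : ℕ → ℝ := fun n =>
    |ZkFaith.prOne (N.randGame A true n) - ZkFaith.prOne (N.randGame A false n)|
  have hadv : ZkFaith.Negligible adv :=
    hrand A (ZkFaith.reduction_ppt a b hF hm hDm hBm hD hB)
  -- The first term is the bound from the hybrid argument, which may be zero; the positive second
  -- term makes the inequality strict.
  refine ⟨fun n => 2 * ((n : ℝ) + 2) ^ b * adv n + (1 / 2 : ℝ) ^ n,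
    (ZkFaith.negligible_pow_mul hadv b).add ZkFaith.negligible_half_pow, fun n => ?_⟩
  set k := ((n + 2) ^ b).size with hk
  have hpos : 0 < (n + 2) ^ b := by positivity
  have hkpos : 0 < k := Nat.size_pos.2 hpos
  have hlt : (n + 2) ^ b < 2 ^ k := Nat.lt_size_self _
  -- Fair coins yield exactly uniform indices only below powers of two. Rounding the number of
  -- hybrids up to one costs at most a factor `2`.
  have hle : 2 ^ k ≤ 2 * (n + 2) ^ b := by
    have h1 : 2 ^ (k - 1) ≤ (n + 2) ^ b := Nat.lt_size.1 (by omega)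
    have h2 : 2 ^ k = 2 * 2 ^ (k - 1) := by
      rw [← pow_succ']; congr 1; omega
    omega
  have htel := ZkFaith.prOne_hybrids k (ZkFaith.hybrid N B D a n)
  have hgame := ZkFaith.randGame_reduction hcomplete hB hD hF hm hDm hBm a b n
  have ht := hgame true
  have hf := hgame false
  simp only [Bool.toNat_true, Bool.toNat_false, Nat.add_zero, ← hk] at ht hf
  rw [(hab n).1, (hab n).2 _ hlt.le, abs_sub_comm, ← htel]
  have hcast : (2 : ℝ) ^ k ≤ 2 * ((n : ℝ) + 2) ^ b := by exact_mod_cast hle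
  have hle' : |2 ^ k * (ZkFaith.prOne ((ZkFaith.uniformBelow k).bind fun i =>
      ZkFaith.hybrid N B D a n (i + 1)) - ZkFaith.prOne ((ZkFaith.uniformBelow k).bind
      (ZkFaith.hybrid N B D a n)))| ≤ 2 * ((n : ℝ) + 2) ^ b * adv n := by
    rw [abs_mul, abs_of_nonneg (by positivity : (0 : ℝ) ≤ 2 ^ k)]
    refine (mul_le_mul_of_nonneg_right hcast (abs_nonneg _)).trans (le_of_eq ?_)
    simp only [adv, A, ht, hf]
  exact lt_add_of_le_of_pos hle' (by positivity)
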